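/- Let $d,m\ge 0$ be integers, let $R$ be the rectangular Young diagram with $d$ rows and $m$ columns, let $N=dm$, and let $\mathsf{SYT}(R)$ be the set of standard Young tableaux of shape $R$ (fillings of the boxes with $1,\dots,N$, each used once, increasing along rows and down columns). For $1\le i\le N$ let $j_i:\mathsf{SYT}(R)\to\mathsf{SYT}(R)$ be jeu de taquin promotion restricted to the entries $1,\dots,i$: delete the entry $1$, leaving an empty box in the northwest corner; repeatedly swap the empty box with whichever of its eastern and southern neighbours has the smaller entry, considering only neighbours with entries at most $i$, until there is no such neighbour; then decrease all remaining entries that are at most $i$ by $1$ and put $i$ into the empty box (the entries larger than $i$ stay fixed). Put $j=j_N$, and for $0\le k\le N$ let $e_k=j_1\circ j_2\circ\dots\circ j_k$ (with $e_0=\mathrm{id}$) and $e=e_N$; thus $j$ is promotion, $e$ is evacuation, and $e_k$ is evacuation of the entries $1,\dots,k$. Suppose that $N$ is even. Then the number of tableaux $T\in\mathsf{SYT}(R)$ with $e(T)=T$ equals the number of $T\in\mathsf{SYT}(R)$ with $j^{N/2}(T)=T$. Moreover, $$e\circ e_{N/2}=e_{N/2}\circ j^{N/2}$$ on $\mathsf{SYT}(R)$,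 the map $e_{N/2}$ is an involution of $\mathsf{SYT}(R)$, and it restricts to a bijection from the set of $e$-fixed tableaux onto the set of $j^{N/2}$-fixed tableaux in $\mathsf{SYT}(R)$. -/

import Mathlib

/-- A standard Young tableau of shape `μ`: a semistandard tableau whose entries are exactly the
numbers `1, …, |μ|`, each occurring once. Boxes are `(row, column)`, counted from the northwest
corner `(0, 0)`; as for semistandard tableaux, the filling is `0` outside `μ`. -/
structure StandardYoungTableau (μ : YoungDiagram) extends SemistandardYoungTableau μ where
  /-- Every number `1, …, |μ|` is the entry of exactly one box. -/
  bijOn' : Set.BijOn (fun c : ℕ × ℕ => entry c.1 c.2) (μ.cells : Set (ℕ × ℕ)) (Set.Icc 1 μ.card)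

/-- The rectangular diagram with `d` rows and `m` columns. -/
def rectDiagram (d m : ℕ) : YoungDiagram where
  cells := Finset.range d ×ˢ Finset.range m
  isLowerSet := by
    rintro ⟨a, b⟩ ⟨a', b'⟩ ⟨h1, h2⟩ h
    simp only [Finset.coe_product, Finset.coe_range, Set.mem_prod, Set.mem_Iio] at h ⊢
    exact ⟨lt_of_le_of_lt h1 h.1, lt_of_le_of_lt h2 h.2⟩

namespace StandardYoungTableau

/-- The entries of `T` as a function of the box. -/
def filling {μ : YoungDiagram} (T : StandardYoungTableau μ) (c : ℕ × ℕ) : ℕ :=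
  T.entry c.1 c.2

theorem filling_injective {μ : YoungDiagram} :
    Function.Injective (filling : StandardYoungTableau μ → ℕ × ℕ → ℕ) := by
  rintro ⟨⟨e, _, _, _⟩, _⟩ ⟨⟨e', _, _, _⟩, _⟩ h
  have : e = e' := by
    funext i j
    exact congrFun h (i, j)
  subst this
  rfl

theorem filling_zeros {μ : YoungDiagram} (T : StandardYoungTableau μ) {c : ℕ × ℕ} (h : c ∉ μ) :
    T.filling c = 0 :=
  T.zeros' h

theorem filling_bijOn {μ : YoungDiagram} (T : StandardYoungTableau μ) :
    Set.BijOn T.filling (μ.cells : Set (ℕ × ℕ)) (Set.Icc 1 μ.card) :=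
  T.bijOn'

theorem filling_strictMonoOn {μ : YoungDiagram} (T : StandardYoungTableau μ) :
    StrictMonoOn T.filling (μ.cells : Set (ℕ × ℕ)) := by
  rintro ⟨a, b⟩ hc ⟨a', b'⟩ hc' hlt
  have hle : a ≤ a' ∧ b ≤ b' := hlt.le
  have hmid : (a, b') ∈ μ := μ.up_left_mem hle.1 le_rfl hc'
  have h1 : T.filling (a, b) ≤ T.filling (a, b') :=
    T.toSemistandardYoungTableau.row_weak_of_le hle.2 hmid
  have h2 : T.filling (a, b') ≤ T.filling (a', b') :=
    T.toSemistandardYoungTableau.col_weak hle.1 hc'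
  refine lt_of_le_of_ne (h1.trans h2) fun h => ?_
  exact hlt.ne (T.filling_bijOn.injOn hc hc' h)

/-- Build a standard tableau from a filling that increases strictly southeastwards. -/
def ofFilling {μ : YoungDiagram} (f : ℕ × ℕ → ℕ) (h0 : ∀ c, c ∉ μ → f c = 0)
    (hm : StrictMonoOn f (μ.cells : Set (ℕ × ℕ)))
    (hb : Set.BijOn f (μ.cells : Set (ℕ × ℕ)) (Set.Icc 1 μ.card)) : StandardYoungTableau μ where
  entry i j := f (i, j)
  row_weak' hj hc :=
    (hm (μ.up_left_mem le_rfl hj.le hc) hc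
      (Prod.mk_lt_mk.2 (Or.inr ⟨le_rfl, hj⟩))).le
  col_strict' hi hc :=
    hm (μ.up_left_mem hi.le le_rfl hc) hc (Prod.mk_lt_mk.2 (Or.inl ⟨hi, le_rfl⟩))
  zeros' h := h0 _ h
  bijOn' := hb

instance instFinite (μ : YoungDiagram) : Finite (StandardYoungTableau μ) := by
  let F : StandardYoungTableau μ → ({c // c ∈ μ.cells} → Fin (μ.card + 1)) := fun T c =>
    ⟨T.filling c.1, Nat.lt_succ_of_le (T.filling_bijOn.mapsTo c.2).2⟩
  refine Finite.of_injective F fun T T' h => filling_injective (funext fun c => ?_)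
  by_cases hc : c ∈ μ
  · exact congrArg Fin.val (congrFun h ⟨c, hc⟩)
  · rw [filling_zeros T hc, filling_zeros T' hc]

/-- The eastern neighbour of a box. -/
def east (b : ℕ × ℕ) : ℕ × ℕ := (b.1, b.2 + 1)

/-- The southern neighbour of a box. -/
def south (b : ℕ × ℕ) : ℕ × ℕ := (b.1 + 1, b.2)

/-- One step of a slide within the entries `1, …, i`. The state is a filling together with the
position of the empty box (whose entry is `0`, as is that of every box outside the diagram). The
empty box swaps places with its eastern or its southern neighbour, whichever has the smaller entry
among those that carry an entry in `1, …, i`; if there is none, nothing happens. -/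
def slideStep (i : ℕ) (s : (ℕ × ℕ → ℕ) × (ℕ × ℕ)) : (ℕ × ℕ → ℕ) × (ℕ × ℕ) :=
  let x := s.1 (east s.2)
  let y := s.1 (south s.2)
  if (1 ≤ x ∧ x ≤ i) ∧ ((1 ≤ y ∧ y ≤ i) → x < y) then
    (s.1 ∘ Equiv.swap s.2 (east s.2), east s.2)
  else if 1 ≤ y ∧ y ≤ i then
    (s.1 ∘ Equiv.swap s.2 (south s.2), south s.2)
  else s

/-- Delete the entry in the northwest corner and slide the empty box through the entries
`1, …, i` until it is stuck. Every move passes a larger entry than the one before, so that `i`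
steps are more than enough; see `slide_stuck`. -/
def slide (i : ℕ) (f : ℕ × ℕ → ℕ) : (ℕ × ℕ → ℕ) × (ℕ × ℕ) :=
  (slideStep i)^[i] (Function.update f (0, 0) 0, (0, 0))

/-- Promotion of the entries `1, …, i` of a filling: delete the entry `1`, slide the empty box
through the entries at most `i`, decrement these and put `i` into the empty box. Entries larger
than `i` are frozen. -/
def promoteFilling (i : ℕ) (f : ℕ × ℕ → ℕ) (c : ℕ × ℕ) : ℕ :=
  let s := slide i f
  if c = s.2 then i else if s.1 c ≤ i then s.1 c - 1 else s.1 c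

/-- What holds after `n` steps of the slide: the last clause says that the slide has stopped or
has passed `n` different entries. -/
structure SlideInv (μ : YoungDiagram) (i n : ℕ) (s : (ℕ × ℕ → ℕ) × (ℕ × ℕ)) : Prop where
  mem : s.2 ∈ μ
  empty : s.1 s.2 = 0
  zeros : ∀ c, c ∉ μ → s.1 c = 0
  mono : StrictMonoOn s.1 ((μ.cells : Set (ℕ × ℕ)) \ {s.2})
  bij : Set.BijOn s.1 ((μ.cells : Set (ℕ × ℕ)) \ {s.2}) (Set.Icc 2 μ.card)
  before : ∀ c, c < s.2 → s.1 c ≤ i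
  after : (∀ c ∈ μ, s.2 < c → i < s.1 c) ∨ (∀ c ∈ μ, s.2 < c → n + 2 ≤ s.1 c)

theorem lt_east (b : ℕ × ℕ) : b < east b :=
  Prod.mk_lt_mk.2 (Or.inr ⟨le_rfl, Nat.lt_succ_self _⟩)

theorem lt_south (b : ℕ × ℕ) : b < south b :=
  Prod.mk_lt_mk.2 (Or.inl ⟨Nat.lt_succ_self _, le_rfl⟩)

theorem east_le_or_south_le {b c : ℕ × ℕ} (h : b < c) : east b ≤ c ∨ south b ≤ c := by
  rcases Prod.lt_iff.1 h with h | h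
  · exact Or.inr ⟨h.1, h.2⟩
  · exact Or.inl ⟨h.1, h.2⟩


/-- A move of the empty box to a neighbour `b'` preserves the invariant. -/
theorem SlideInv.move {μ : YoungDiagram} {i n : ℕ} {f : ℕ × ℕ → ℕ} {b b' : ℕ × ℕ}
    (h : SlideInv μ i n (f, b)) (hb : b < b') (hx : 1 ≤ f b') (hxi : f b' ≤ i)
    (hmin : ∀ c ∈ μ, b < c → c ≠ b' → f b' < f c) :
    SlideInv μ i (n + 1) (f ∘ Equiv.swap b b', b') := by
  have hb' : b' ∈ μ := by
    by_contra hc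
    have := h.zeros b' hc
    simp only at this
    omega
  have hne : b ≠ b' := hb.ne
  have hval : ∀ c, c ≠ b → c ≠ b' → (f ∘ Equiv.swap b b') c = f c := fun c h1 h2 => by
    simp [Equiv.swap_apply_of_ne_of_ne h1 h2]
  have hvb : (f ∘ Equiv.swap b b') b = f b' := by simp
  have hvb' : (f ∘ Equiv.swap b b') b' = f b := by simp
  have mono : ∀ c ∈ μ, ∀ c' ∈ μ, c ≠ b → c' ≠ b → c < c' → f c < f c' :=
    fun c hc c' hc' h1 h2 hlt => h.mono ⟨hc, h1⟩ ⟨hc', h2⟩ hlt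
  refine ⟨hb', hvb'.trans h.empty, ?_, ?_, ?_, ?_, ?_⟩
  · intro c hc
    have h1 : c ≠ b := fun e => hc (e ▸ h.mem)
    have h2 : c ≠ b' := fun e => hc (e ▸ hb')
    exact (hval c h1 h2).trans (h.zeros c hc)
  · rintro c ⟨hc, hcb'⟩ c' ⟨hc', hcb''⟩ hlt
    change (f ∘ Equiv.swap b b') c < (f ∘ Equiv.swap b b') c'
    have hcb' : c ≠ b' := hcb'
    have hcb'' : c' ≠ b' := hcb''
    by_cases h1 : c = b
    · subst h1
      rw [hvb, hval c' hlt.ne' hcb'']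
      exact hmin c' hc' hlt hcb''
    · rw [hval c h1 hcb']
      by_cases h2 : c' = b
      · subst h2
        rw [hvb]
        exact mono c hc b' hb' h1 hne.symm (hlt.trans hb)
      · rw [hval c' h2 hcb'']
        exact mono c hc c' hc' h1 h2 hlt
  · have hs : Set.BijOn (Equiv.swap b b') ((μ.cells : Set (ℕ × ℕ)) \ {b'})
        ((μ.cells : Set (ℕ × ℕ)) \ {b}) := by
      refine ⟨?_, (Equiv.injective _).injOn, ?_⟩
      · rintro c ⟨hc, hcb⟩
        have hcb : c ≠ b' := hcb
        by_cases h1 : c = b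
        · subst h1
          rw [Equiv.swap_apply_left]
          exact ⟨hb', hne.symm⟩
        · rw [Equiv.swap_apply_of_ne_of_ne h1 hcb]
          exact ⟨hc, h1⟩
      · rintro c ⟨hc, hcb⟩
        have hcb : c ≠ b := hcb
        by_cases h1 : c = b'
        · subst h1
          exact ⟨b, ⟨h.mem, hne⟩, Equiv.swap_apply_left _ _⟩
        · exact ⟨c, ⟨hc, h1⟩, Equiv.swap_apply_of_ne_of_ne hcb h1⟩
    exact h.bij.comp hs
  · intro c hlt
    change (f ∘ Equiv.swap b b') c ≤ i
    by_cases h1 : c = b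
    · rw [h1, hvb]
      exact hxi
    · rw [hval c h1 hlt.ne]
      have hc : c ∈ μ := μ.up_left_mem hlt.le.1 hlt.le.2 hb'
      exact (mono c hc b' hb' h1 hne.symm hlt).le.trans hxi
  · have hgt : ∀ c ∈ μ, b' < c → f b' < (f ∘ Equiv.swap b b') c := by
      intro c hc hlt
      rw [hval c (hb.trans hlt).ne' hlt.ne']
      exact mono b' hb' c hc hne.symm (hb.trans hlt).ne' hlt
    rcases h.after with h3 | h3
    · exact absurd (h3 b' hb' hb) (not_lt.2 hxi)
    · right
      intro c hc hlt
      have := h3 b' hb' hb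
      have := hgt c hc hlt
      simp only at *
      omega

theorem SlideInv.step {μ : YoungDiagram} {i n : ℕ} {s : (ℕ × ℕ → ℕ) × (ℕ × ℕ)}
    (h : SlideInv μ i n s) : SlideInv μ i (n + 1) (slideStep i s) := by
  obtain ⟨f, b⟩ := s
  have hpos : ∀ c ∈ μ, b < c → 1 ≤ f c := fun c hc hlt => by
    have := (h.bij.mapsTo ⟨hc, hlt.ne'⟩).1
    simp only at this
    omega
  have mono : ∀ c ∈ μ, ∀ c' ∈ μ, b < c → c ≤ c' → f c ≤ f c' := by
    intro c hc c' hc' hbc hcc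
    rcases eq_or_lt_of_le hcc with e | e
    · rw [e]
    · exact (h.mono ⟨hc, hbc.ne'⟩ ⟨hc', (hbc.trans e).ne'⟩ e).le
  have smono : ∀ c ∈ μ, ∀ c' ∈ μ, b < c → c < c' → f c < f c' := fun c hc c' hc' hbc e =>
    h.mono ⟨hc, hbc.ne'⟩ ⟨hc', (hbc.trans e).ne'⟩ e
  have hdown : ∀ c c', c' ∈ μ → c ≤ c' → c ∈ μ := fun c c' hc' hle =>
    μ.up_left_mem hle.1 hle.2 hc'
  unfold slideStep
  simp only
  split_ifs with h1 h2
  · refine h.move (lt_east b) h1.1.1 h1.1.2 fun c hc hlt hcne => ?_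
    rcases east_le_or_south_le hlt with hle | hle
    · exact smono _ (hdown _ _ hc hle) c hc (lt_east b) (lt_of_le_of_ne hle hcne.symm)
    · have hs := hdown _ _ hc hle
      have h3 := hpos _ hs (lt_south b)
      have h4 := mono _ hs c hc (lt_south b) hle
      have h5 := h1.1.2
      by_cases h6 : f (south b) ≤ i
      · exact lt_of_lt_of_le (h1.2 ⟨h3, h6⟩) h4
      · omega
  · refine h.move (lt_south b) h2.1 h2.2 fun c hc hlt hcne => ?_
    rcases east_le_or_south_le hlt with hle | hle
    · have hs := hdown _ _ hc hle
      have h3 := hpos _ hs (lt_east b)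
      have h4 := mono _ hs c hc (lt_east b) hle
      have h7 : f (south b) ≤ f (east b) := by
        by_contra hcon
        exact h1 ⟨⟨h3, by omega⟩, fun _ => by omega⟩
      have h8 : f (south b) ≠ f (east b) := by
        intro e
        have hsm : south b ∈ μ := by
          by_contra hc
          have := h.zeros _ hc
          simp only at this
          omega
        have := h.bij.injOn ⟨hsm, (lt_south b).ne'⟩ ⟨hs, (lt_east b).ne'⟩ e
        simp [south, east] at this
      omega
    · exact smono _ (hdown _ _ hc hle) c hc (lt_south b) (lt_of_le_of_ne hle hcne.symm)
  · refine ⟨h.mem, h.empty, h.zeros, h.mono, h.bij, h.before, Or.inl fun c hc hlt => ?_⟩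
    simp only at hlt ⊢
    rcases east_le_or_south_le hlt with hle | hle
    · have hs := hdown _ _ hc hle
      have h3 := hpos _ hs (lt_east b)
      have h4 := mono _ hs c hc (lt_east b) hle
      by_contra hcon
      exact h1 ⟨⟨h3, by omega⟩, fun h5 => absurd h5 h2⟩
    · have hs := hdown _ _ hc hle
      have h3 := hpos _ hs (lt_south b)
      have h4 := mono _ hs c hc (lt_south b) hle
      by_contra hcon
      exact h2 ⟨h3, by omega⟩

theorem zero_mem {μ : YoungDiagram} (h : 1 ≤ μ.card) : ((0, 0) : ℕ × ℕ) ∈ μ := by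
  obtain ⟨c, hc⟩ := Finset.card_pos.1 h
  exact μ.up_left_mem (Nat.zero_le c.1) (Nat.zero_le c.2) hc

theorem filling_zero_zero {μ : YoungDiagram} (T : StandardYoungTableau μ) (h : 1 ≤ μ.card) :
    T.filling (0, 0) = 1 := by
  obtain ⟨c, hc, hc1⟩ := T.filling_bijOn.surjOn (show 1 ∈ Set.Icc 1 μ.card from ⟨le_rfl, h⟩)
  have h1 := (T.filling_bijOn.mapsTo (show (0, 0) ∈ (μ.cells : Set _) from zero_mem h)).1
  have h2 := T.filling_strictMonoOn.monotoneOn (zero_mem h) hc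
    (show ((0, 0) : ℕ × ℕ) ≤ c from ⟨Nat.zero_le _, Nat.zero_le _⟩)
  omega

theorem slideInv_zero {μ : YoungDiagram} (T : StandardYoungTableau μ) (i : ℕ)
    (h : 1 ≤ μ.card) : SlideInv μ i 0 (Function.update T.filling (0, 0) 0, (0, 0)) := by
  have hv : ∀ c : ℕ × ℕ, c ≠ (0, 0) → Function.update T.filling (0, 0) 0 c = T.filling c :=
    fun c hc => Function.update_of_ne hc _ _
  have h00 := T.filling_zero_zero h
  have hbij : Set.BijOn (Function.update T.filling (0, 0) 0)
      ((μ.cells : Set (ℕ × ℕ)) \ {(0, 0)}) (Set.Icc 2 μ.card) := by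
    refine ⟨?_, ?_, ?_⟩
    · rintro c ⟨hc, hne⟩
      rw [hv c hne]
      have h1 := T.filling_bijOn.mapsTo hc
      refine ⟨?_, h1.2⟩
      have h2 : T.filling c ≠ 1 := fun e =>
        hne (T.filling_bijOn.injOn hc (zero_mem h) (e.trans h00.symm))
      have := h1.1
      omega
    · rintro c ⟨hc, hne⟩ c' ⟨hc', hne'⟩ e
      rw [hv c hne, hv c' hne'] at e
      exact T.filling_bijOn.injOn hc hc' e
    · rintro k ⟨hk, hk'⟩
      obtain ⟨c, hc, e⟩ := T.filling_bijOn.surjOn (show k ∈ Set.Icc 1 μ.card from ⟨by omega, hk'⟩)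
      have hne : c ≠ (0, 0) := fun e' => by
        rw [e', h00] at e
        omega
      exact ⟨c, ⟨hc, hne⟩, (hv c hne).trans e⟩
  refine ⟨zero_mem h, by simp, ?_, ?_, hbij, ?_, Or.inr ?_⟩
  · intro c hc
    have hne : c ≠ (0, 0) := fun e => hc (e ▸ zero_mem h)
    exact (hv c hne).trans (T.filling_zeros hc)
  · rintro c ⟨hc, hne⟩ c' ⟨hc', hne'⟩ hlt
    change Function.update T.filling (0, 0) 0 c < Function.update T.filling (0, 0) 0 c'
    rw [hv c hne, hv c' hne']
    exact T.filling_strictMonoOn hc hc' hlt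
  · intro c hlt
    exact absurd hlt (not_lt_of_ge (show ((0, 0) : ℕ × ℕ) ≤ c from ⟨Nat.zero_le _, Nat.zero_le _⟩))
  · intro c hc hlt
    exact (hbij.mapsTo ⟨hc, hlt.ne'⟩).1

theorem slideInv_slide {μ : YoungDiagram} (T : StandardYoungTableau μ) (i : ℕ)
    (h : 1 ≤ μ.card) : SlideInv μ i i (slide i T.filling) := by
  have : ∀ n, SlideInv μ i n
      ((slideStep i)^[n] (Function.update T.filling (0, 0) 0, (0, 0))) := by
    intro n
    induction n with
    | zero => exact slideInv_zero T i h
    | succ n ih =>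
      rw [Function.iterate_succ_apply']
      exact ih.step
  exact this i

/-- At the end of the slide, all boxes southeast of the empty box carry frozen entries. -/
theorem slide_stuck {μ : YoungDiagram} (T : StandardYoungTableau μ) (i : ℕ) (h : 1 ≤ μ.card) :
    ∀ c ∈ μ, (slide i T.filling).2 < c → i < (slide i T.filling).1 c := by
  intro c hc hlt
  rcases (slideInv_slide T i h).after with h1 | h1
  · exact h1 c hc hlt
  · have := h1 c hc hlt
    omega

theorem promoteFilling_spec {μ : YoungDiagram} (T : StandardYoungTableau μ) {i : ℕ}
    (hi : 1 ≤ i ∧ i ≤ μ.card) :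
    (∀ c, c ∉ μ → promoteFilling i T.filling c = 0) ∧
    StrictMonoOn (promoteFilling i T.filling) (μ.cells : Set (ℕ × ℕ)) ∧
    Set.BijOn (promoteFilling i T.filling) (μ.cells : Set (ℕ × ℕ)) (Set.Icc 1 μ.card) := by
  have hN : 1 ≤ μ.card := hi.1.trans hi.2
  have hI := slideInv_slide T i hN
  have hst := slide_stuck T i hN
  unfold promoteFilling
  generalize slide i T.filling = s at hI hst
  obtain ⟨f, b⟩ := s
  simp only at hst ⊢
  have hr : ∀ c ∈ μ, c ≠ b → 2 ≤ f c ∧ f c ≤ μ.card := fun c hc hne => hI.bij.mapsTo ⟨hc, hne⟩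
  have hm : StrictMonoOn (fun c => if c = b then i else if f c ≤ i then f c - 1 else f c)
      (μ.cells : Set (ℕ × ℕ)) := by
    intro c hc c' hc' hlt
    simp only
    by_cases h1 : c = b
    · have h2 : c' ≠ b := fun e => hlt.ne (h1.trans e.symm)
      have h3 := hst c' hc' (h1 ▸ hlt)
      rw [if_pos h1, if_neg h2, if_neg (by omega)]
      exact h3
    · have h3 := hr c hc h1
      by_cases h2 : c' = b
      · have h4 : f c ≤ i := hI.before c (h2 ▸ hlt)
        rw [if_neg h1, if_pos h2, if_pos h4]
        omega
      · have h4 : f c < f c' := hI.mono ⟨hc, h1⟩ ⟨hc', h2⟩ hlt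
        rw [if_neg h1, if_neg h2]
        split_ifs <;> omega
  have hinj : Set.InjOn (fun c => if c = b then i else if f c ≤ i then f c - 1 else f c)
      (μ.cells : Set (ℕ × ℕ)) := by
    intro c hc c' hc' he
    simp only at he
    by_cases h1 : c = b
    · by_cases h2 : c' = b
      · exact h1.trans h2.symm
      · have := hr c' hc' h2
        rw [if_pos h1, if_neg h2] at he
        split_ifs at he <;> omega
    · have := hr c hc h1
      by_cases h2 : c' = b
      · rw [if_neg h1, if_pos h2] at he
        split_ifs at he <;> omega
      · have := hr c' hc' h2
        refine hI.bij.injOn ⟨hc, h1⟩ ⟨hc', h2⟩ ?_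
        simp only
        rw [if_neg h1, if_neg h2] at he
        split_ifs at he <;> omega
  refine ⟨?_, hm, ?_, hinj, ?_⟩
  · intro c hc
    have h1 : c ≠ b := fun e => hc (e ▸ hI.mem)
    have h2 : f c = 0 := hI.zeros c hc
    simp [h1, h2]
  · intro c hc
    simp only
    by_cases h1 : c = b
    · rw [if_pos h1]
      exact hi
    · have := hr c hc h1
      rw [if_neg h1]
      split_ifs
      · exact ⟨by omega, by omega⟩
      · exact ⟨by omega, by omega⟩
  · rintro k ⟨hk, hk'⟩
    rcases lt_trichotomy k i with h | h | h
    · obtain ⟨c, ⟨hc, hne⟩, e⟩ := hI.bij.surjOn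
        (show k + 1 ∈ Set.Icc 2 μ.card from ⟨by omega, by omega⟩)
      have hne : c ≠ b := hne
      simp only at e
      refine ⟨c, hc, ?_⟩
      simp only
      rw [if_neg hne, if_pos (by omega)]
      omega
    · exact ⟨b, hI.mem, by simp [h]⟩
    · obtain ⟨c, ⟨hc, hne⟩, e⟩ := hI.bij.surjOn
        (show k ∈ Set.Icc 2 μ.card from ⟨by omega, hk'⟩)
      have hne : c ≠ b := hne
      simp only at e
      refine ⟨c, hc, ?_⟩
      simp only
      rw [if_neg hne, if_neg (by omega)]
      exact e

/-- The promotion operator restricted to the entries `1, …, i`, for `1 ≤ i ≤ |μ|`. (For other `i`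
there are no such entries to promote and the value is `T`, by convention.) -/
def promoteUpTo {μ : YoungDiagram} (i : ℕ) (T : StandardYoungTableau μ) : StandardYoungTableau μ :=
  if h : 1 ≤ i ∧ i ≤ μ.card then
    ofFilling (promoteFilling i T.filling) (promoteFilling_spec T h).1
      (promoteFilling_spec T h).2.1 (promoteFilling_spec T h).2.2
  else T

/-- The promotion operator `j` on standard Young tableaux of shape `μ`. -/
def promotion {μ : YoungDiagram} (T : StandardYoungTableau μ) : StandardYoungTableau μ :=
  promoteUpTo μ.card T

/-- Evacuation of the entries `1, …, k`: the composite `j_1 ∘ j_2 ∘ ⋯ ∘ j_k`, where `j_i` is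
promotion restricted to the entries `1, …, i` (so `j_k` is applied first). -/
def evacuateUpTo {μ : YoungDiagram} : ℕ → StandardYoungTableau μ → StandardYoungTableau μ
  | 0, T => T
  | k + 1, T => evacuateUpTo k (promoteUpTo (k + 1) T)

/-- The evacuation operator `e` on standard Young tableaux of shape `μ`. -/
def evacuation {μ : YoungDiagram} (T : StandardYoungTableau μ) : StandardYoungTableau μ :=
  evacuateUpTo μ.card T

end StandardYoungTableau

/-! Record a tableau by the contents (column minus row) of its boxes in the order of their entries.
Increasing the bound of a promotion from `i` to `i + 1` exchanges the entries `i` and `i + 1` of the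
result unless their boxes are neighbours. So on content words promotion and the partial evacuations
are products of involutions `toggle k`, where toggles at distance at least 2 commute.

Let `r` reverse and complement a word of length N; it conjugates the k-th toggle to the (N-2-k)-th.
These relations alone give `ToggleWord.prom_pow`, and for N = 2n they give `prom_iterate_half`: the
n-th power of promotion is e_n r e_n r e. On a rectangle e acts as r (`evac_contentWord_rect`),
which leaves j^n = e_n e e_n. As e_n is an involution, this is the asserted identity, and it
exhibits j^n as a conjugate of e, whence the bijection of fixed points.

That e acts as r on a rectangle is shown with Knuth moves on content words (elementary dual
equivalences). Both e and r carry the move at place i to the move at place N-3-i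
(`IsPath.evac_knuth`, `revCompl_knuth`), and all content words of one shape are connected by such
moves (`IsPath.knuth_connected`). Hence one tableau suffices. For the tableau filled row by row,
evacuation reverses the positions of ascents (`IsPath.evac_lt`), and these positions determine the
tableau (`filling_of_ascents`), so both e and r fix it. -/

/-! ### Promotion and evacuation words in a group generated by involutions -/

namespace ToggleWord

variable {G : Type*} [Group G] (s : ℕ → G)

/-- The product `s_{n-1} ⋯ s_1 s_0`. -/
def prom : ℕ → G
  | 0 => 1
  | n + 1 => s n * prom n

/-- The product `prom 0 * prom 1 * ⋯ * prom (n - 1)`. -/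
def evac : ℕ → G
  | 0 => 1
  | n + 1 => evac n * prom s n

variable {s}

theorem commute_prom {g : G} {n : ℕ} (h : ∀ k < n, Commute g (s k)) : Commute g (prom s n) := by
  induction n with
  | zero => exact Commute.one_right g
  | succ n ih => exact (h n n.lt_succ_self).mul_right (ih fun k hk => h k (hk.trans n.lt_succ_self))

/-- The last factor of `evac s n` is `prom s (n - 1)`, so only the generators with index at most `n
- 2` occur. -/
theorem commute_evac {g : G} {n : ℕ} (h : ∀ k, k + 1 < n → Commute g (s k)) :
    Commute g (evac s n) := by
  induction n with
  | zero => exact Commute.one_right g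
  | succ n ih =>
    exact (ih fun k hk => h k (by omega)).mul_right (commute_prom fun k hk => h k (by omega))

/-- The definition appends a promotion on the right; here its inverse appears on the left. The new
generator `s n` commutes with `evac s n`, which involves only indices up to `n - 2`. -/
theorem evac_succ' (h1 : ∀ k, s k * s k = 1) (h2 : ∀ k l, k + 2 ≤ l → Commute (s k) (s l)) (n : ℕ) :
    evac s (n + 1) = (prom s n)⁻¹ * evac s n := by
  induction n with
  | zero => simp [evac, prom]
  | succ n ih =>
    have hc : Commute (s n) (evac s n) := commute_evac fun k hk => (h2 k n (by omega)).symm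
    have hi : (s n)⁻¹ = s n := inv_eq_of_mul_eq_one_left (h1 n)
    calc evac s (n + 2) = evac s (n + 1) * (s n * prom s n) := rfl
      _ = (prom s n)⁻¹ * (evac s n * s n) * prom s n := by rw [ih]; group
      _ = (prom s n)⁻¹ * s n * (evac s n * prom s n) := by rw [← hc.eq]; group
      _ = (prom s (n + 1))⁻¹ * evac s (n + 1) := by simp [evac, prom, hi]

theorem evac_mul_self (h1 : ∀ k, s k * s k = 1) (h2 : ∀ k l, k + 2 ≤ l → Commute (s k) (s l))
    (n : ℕ) : evac s n * evac s n = 1 := by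
  induction n with
  | zero => simp [evac]
  | succ n ih =>
    nth_rewrite 2 [evac_succ' h1 h2]
    calc evac s n * prom s n * ((prom s n)⁻¹ * evac s n) = evac s n * evac s n := by group
      _ = 1 := ih

/-- The leading `k` factors of the product, with indices from `k + L - 1` down to `L`, are the
conjugates under `r` of `s 0, …, s (k - 1)` in this order, which is the order of an inverse
promotion. -/
theorem prom_add {r : G} {k L : ℕ} (h1 : ∀ k, s k * s k = 1)
    (hr : ∀ i j, i + j + 1 = k + L → r * s i * r⁻¹ = s j) :
    prom s (k + L) = r * (prom s k)⁻¹ * r⁻¹ * prom s L := by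
  have key : ∀ i ≤ k, prom s (k + L) = r * (prom s i)⁻¹ * r⁻¹ * prom s (k + L - i) := by
    intro i
    induction i with
    | zero => simp [prom]
    | succ i ih =>
      intro hi
      have hinv : (s i)⁻¹ = s i := inv_eq_of_mul_eq_one_left (h1 i)
      obtain ⟨j, hj⟩ : ∃ j, k + L - i = j + 1 := ⟨k + L - i - 1, by omega⟩
      rw [ih (by omega), hj, show k + L - (i + 1) = j by omega, prom, ← hr i j (by omega), prom,
        mul_inv_rev, hinv]
      group
  simpa using key k le_rfl

/-- Powers of promotion in terms of partial evacuations. -/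
theorem prom_pow {r : G} {n k L : ℕ} (h1 : ∀ k, s k * s k = 1)
    (h2 : ∀ k l, k + 2 ≤ l → Commute (s k) (s l))
    (hr : ∀ i j, i + j + 2 = n → r * s i * r⁻¹ = s j) (hn : k + L = n) :
    prom s (n - 1) ^ k = r * evac s k * r⁻¹ * evac s L * evac s n := by
  induction k generalizing L with
  | zero =>
    have : L = n := by omega
    subst this
    simp [evac, evac_mul_self h1 h2]
  | succ k ih =>
    -- The conjugated evacuation involves indices at least `L + 1`, and `prom s L` indices at most
    -- `L - 1`.
    have hcomm : Commute (r * evac s k * r⁻¹) (prom s L) := by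
      refine commute_prom fun i hi => ?_
      have : Commute (r⁻¹ * s i * r) (evac s k) := by
        refine commute_evac fun l hl => ?_
        have := hr (n - 2 - i) i (by omega)
        rw [← this]
        have h3 := (h2 l (n - 2 - i) (by omega)).symm
        simpa [mul_assoc] using h3
      have h4 := this.eq
      refine Commute.symm ?_
      change s i * (r * evac s k * r⁻¹) = r * evac s k * r⁻¹ * s i
      calc s i * (r * evac s k * r⁻¹) = r * ((r⁻¹ * s i * r) * evac s k) * r⁻¹ := by group
        _ = _ := by rw [h4]; group
    have hp : prom s (n - 1) = r * (prom s k)⁻¹ * r⁻¹ * prom s L := by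
      have := prom_add (s := s) (r := r) (k := k) (L := L) h1 fun i j hij => hr i j (by omega)
      rwa [show k + L = n - 1 by omega] at this
    rw [pow_succ', ih (L := L + 1) (by omega), evac_succ' h1 h2 L]
    nth_rewrite 1 [hp]
    calc r * (prom s k)⁻¹ * r⁻¹ * prom s L *
          (r * evac s k * r⁻¹ * ((prom s L)⁻¹ * evac s L) * evac s n)
        = r * (prom s k)⁻¹ * r⁻¹ * (prom s L * (r * evac s k * r⁻¹)) * (prom s L)⁻¹ *
            evac s L * evac s n := by group
      _ = r * ((prom s k)⁻¹ * evac s k) * r⁻¹ * evac s L * evac s n := by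
          rw [← hcomm.eq]; group
      _ = _ := by rw [← evac_succ' h1 h2 k]

end ToggleWord

/-! ### Toggles of content words -/

namespace ContentWord

/-- Exchange the letters at the places `k` and `k + 1` if they differ by at least `2`. -/
def toggle (k : ℕ) (w : ℕ → ℤ) : ℕ → ℤ :=
  if |w k - w (k + 1)| ≤ 1 then w else w ∘ Equiv.swap k (k + 1)

theorem toggle_left (k : ℕ) (w : ℕ → ℤ) :
    toggle k w k = if |w k - w (k + 1)| ≤ 1 then w k else w (k + 1) := by
  unfold toggle; split_ifs <;> simp

theorem toggle_right (k : ℕ) (w : ℕ → ℤ) :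
    toggle k w (k + 1) = if |w k - w (k + 1)| ≤ 1 then w (k + 1) else w k := by
  unfold toggle; split_ifs <;> simp

theorem toggle_of_ne {k l : ℕ} (w : ℕ → ℤ) (h1 : l ≠ k) (h2 : l ≠ k + 1) :
    toggle k w l = w l := by
  unfold toggle; split_ifs <;> simp [Equiv.swap_apply_of_ne_of_ne h1 h2]

theorem toggle_toggle (k : ℕ) (w : ℕ → ℤ) : toggle k (toggle k w) = w := by
  funext l
  by_cases h1 : l = k
  · subst h1
    rw [toggle_left, toggle_left, toggle_right]
    split_ifs <;> grind
  by_cases h2 : l = k + 1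
  · subst h2
    rw [toggle_right, toggle_left, toggle_right]
    split_ifs <;> grind
  rw [toggle_of_ne _ h1 h2, toggle_of_ne _ h1 h2]

theorem toggle_comm {k l : ℕ} (h : k + 2 ≤ l) (w : ℕ → ℤ) :
    toggle k (toggle l w) = toggle l (toggle k w) := by
  have e1 : toggle l w k = w k := toggle_of_ne _ (by omega) (by omega)
  have e2 : toggle l w (k + 1) = w (k + 1) := toggle_of_ne _ (by omega) (by omega)
  have e3 : toggle k w l = w l := toggle_of_ne _ (by omega) (by omega)
  have e4 : toggle k w (l + 1) = w (l + 1) := toggle_of_ne _ (by omega) (by omega)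
  funext i
  by_cases h1 : i = k
  · subst h1
    rw [toggle_left, e1, e2, toggle_of_ne _ (by omega) (by omega), toggle_left]
  by_cases h2 : i = k + 1
  · subst h2
    rw [toggle_right, e1, e2, toggle_of_ne _ (by omega) (by omega), toggle_right]
  rw [toggle_of_ne _ h1 h2]
  by_cases h3 : i = l
  · subst h3
    rw [toggle_left, toggle_left, e3, e4]
  by_cases h4 : i = l + 1
  · subst h4
    rw [toggle_right, toggle_right, e3, e4]
  rw [toggle_of_ne _ h3 h4, toggle_of_ne _ h3 h4, toggle_of_ne _ h1 h2]

/-- The toggles as permutations of the set of words. -/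
def togglePerm (k : ℕ) : Equiv.Perm (ℕ → ℤ) :=
  ⟨toggle k, toggle k, toggle_toggle k, toggle_toggle k⟩

theorem togglePerm_mul_self (k : ℕ) : togglePerm k * togglePerm k = 1 :=
  Equiv.ext (toggle_toggle k)

theorem togglePerm_commute (k l : ℕ) (h : k + 2 ≤ l) : Commute (togglePerm k) (togglePerm l) :=
  Equiv.ext (toggle_comm h)

/-- Promotion of the first `n + 1` letters. -/
def prom (n : ℕ) : Equiv.Perm (ℕ → ℤ) := ToggleWord.prom togglePerm n

/-- Evacuation of the first `n` letters. -/
def evac (n : ℕ) : Equiv.Perm (ℕ → ℤ) := ToggleWord.evac togglePerm n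

theorem prom_zero (w : ℕ → ℤ) : prom 0 w = w := rfl

theorem prom_succ (n : ℕ) (w : ℕ → ℤ) : prom (n + 1) w = toggle n (prom n w) := rfl

theorem evac_succ (n : ℕ) (w : ℕ → ℤ) : evac (n + 1) w = evac n (prom n w) := rfl

/-- The second recursion for evacuation. It serves the inductions below at the first place of a
word, which the defining recursion does not reach. -/
theorem prom_evac_succ (n : ℕ) (w : ℕ → ℤ) : prom n (evac (n + 1) w) = evac n w := by
  have := ToggleWord.evac_succ' togglePerm_mul_self togglePerm_commute n
  have h : prom n * evac (n + 1) = evac n := by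
    unfold prom evac
    rw [this]
    group
  exact congrArg (fun g : Equiv.Perm (ℕ → ℤ) => g w) h

theorem evac_evac (n : ℕ) (w : ℕ → ℤ) : evac n (evac n w) = w :=
  congrArg (fun g : Equiv.Perm (ℕ → ℤ) => g w)
    (ToggleWord.evac_mul_self togglePerm_mul_self togglePerm_commute n)

/-- Reverse the first `n` letters and replace each of them by its difference from `t`. -/
def revCompl (t : ℤ) (n : ℕ) (w : ℕ → ℤ) (k : ℕ) : ℤ :=
  if k < n then t - w (n - 1 - k) else w k

theorem revCompl_revCompl (t : ℤ) (n : ℕ) (w : ℕ → ℤ) : revCompl t n (revCompl t n w) = w := by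
  funext k
  unfold revCompl
  by_cases h : k < n
  · rw [if_pos h, if_pos (by omega), show n - 1 - (n - 1 - k) = k by omega]
    ring
  · rw [if_neg h, if_neg h]

theorem revCompl_toggle (t : ℤ) {n i j : ℕ} (h : i + j + 2 = n) (w : ℕ → ℤ) :
    revCompl t n (toggle i w) = toggle j (revCompl t n w) := by
  have e1 : revCompl t n w j = t - w (i + 1) := by
    unfold revCompl
    rw [if_pos (by omega), show n - 1 - j = i + 1 by omega]
  have e2 : revCompl t n w (j + 1) = t - w i := by
    unfold revCompl
    rw [if_pos (by omega), show n - 1 - (j + 1) = i by omega]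
  have e3 : |t - w (i + 1) - (t - w i)| = |w i - w (i + 1)| := congrArg _ (by ring)
  funext k
  by_cases h1 : k = j
  · subst h1
    rw [toggle_left, e1, e2, e3]
    unfold revCompl
    rw [if_pos (by omega), show n - 1 - k = i + 1 by omega, toggle_right]
    split_ifs <;> rfl
  by_cases h2 : k = j + 1
  · subst h2
    rw [toggle_right, e1, e2, e3]
    unfold revCompl
    rw [if_pos (by omega), show n - 1 - (j + 1) = i by omega, toggle_left]
    split_ifs <;> rfl
  rw [toggle_of_ne _ h1 h2]
  unfold revCompl
  split_ifs with h3
  · rw [toggle_of_ne _ (by omega) (by omega)]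
  · rw [toggle_of_ne _ (by omega) (by omega)]

/-- `revCompl` as a permutation of the set of words. -/
def revComplPerm (t : ℤ) (n : ℕ) : Equiv.Perm (ℕ → ℤ) :=
  ⟨revCompl t n, revCompl t n, revCompl_revCompl t n, revCompl_revCompl t n⟩

theorem revComplPerm_conj (t : ℤ) {n i j : ℕ} (h : i + j + 2 = n) :
    revComplPerm t n * togglePerm i * (revComplPerm t n)⁻¹ = togglePerm j := by
  rw [mul_inv_eq_iff_eq_mul]
  exact Equiv.ext (revCompl_toggle t h)

/-- The case of two equal halves in `ToggleWord.prom_pow`. The two half evacuations act on disjoint,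
non-interacting places and are interchanged, so that a `revCompl` stands directly next to the full
evacuation and can cancel it on rectangles. -/
theorem prom_iterate_half (t : ℤ) {n k : ℕ} (h : k + k = n) (w : ℕ → ℤ) :
    (prom (n - 1))^[k] w = evac k (revCompl t n (evac k (revCompl t n (evac n w)))) := by
  have h1 := ToggleWord.prom_pow (r := revComplPerm t n) togglePerm_mul_self togglePerm_commute
    (fun i j hij => revComplPerm_conj t hij) h
  have hc : Commute (revComplPerm t n * evac k * (revComplPerm t n)⁻¹) (evac k) := by
    refine ToggleWord.commute_evac fun i hi => ?_
    rw [← revComplPerm_conj t (show (n - 2 - i) + i + 2 = n by omega)]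
    have : Commute (evac k) (togglePerm (n - 2 - i)) :=
      (ToggleWord.commute_evac fun l hl =>
        (togglePerm_commute l (n - 2 - i) (by omega)).symm).symm
    exact (Commute.conj_iff _).2 this
  have h2 : prom (n - 1) ^ k =
      evac k * (revComplPerm t n * evac k * (revComplPerm t n)⁻¹) * evac n := by
    rw [← hc.eq]
    exact h1
  rw [← Equiv.Perm.coe_pow, h2]
  rfl

end ContentWord

namespace ContentWord

/-! ### Paths: words whose letters are the successive local minima of a profile -/

/-- The profile of the shape filled by the first `n` letters: on the diagonal `c` it is
`|c|` plus twice the number of boxes. -/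
def profile (w : ℕ → ℤ) : ℕ → ℤ → ℤ
  | 0, c => |c|
  | n + 1, c => profile w n c + if c = w n then 2 else 0

/-- Local minima of a profile: the contents of the boxes that may be added. -/
def LocMin (h : ℤ → ℤ) (c : ℤ) : Prop := h (c + 1) = h c + 1 ∧ h (c - 1) = h c + 1

/-- Local maxima of a profile: the contents of the boxes that may be removed. -/
def LocMax (h : ℤ → ℤ) (c : ℤ) : Prop := h (c + 1) = h c - 1 ∧ h (c - 1) = h c - 1

/-- The first `n` letters of `w` are the contents of successively added boxes. -/
def IsPath (n : ℕ) (w : ℕ → ℤ) : Prop := ∀ k < n, LocMin (profile w k) (w k)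

theorem IsPath.mono {m n : ℕ} {w : ℕ → ℤ} (h : IsPath n w) (hmn : m ≤ n) : IsPath m w :=
  fun k hk => h k (hk.trans_le hmn)

theorem profile_congr {n : ℕ} {u v : ℕ → ℤ} (h : ∀ k < n, u k = v k) :
    profile u n = profile v n := by
  induction n with
  | zero => rfl
  | succ n ih =>
    funext c
    rw [profile, profile, ih fun k hk => h k (by omega), h n (by omega)]

theorem IsPath.congr {n : ℕ} {u v : ℕ → ℤ} (hu : IsPath n u) (h : ∀ k < n, u k = v k) :
    IsPath n v := fun k hk => by
  rw [← profile_congr fun l hl => h l (hl.trans hk), ← h k hk]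
  exact hu k hk

theorem profile_toggle {k n : ℕ} (w : ℕ → ℤ) (h : n ≠ k + 1) :
    profile (toggle k w) n = profile w n := by
  rcases lt_or_gt_of_ne h with h | h
  · exact profile_congr fun l hl => toggle_of_ne _ (by omega) (by omega)
  · obtain ⟨j, rfl⟩ : ∃ j, n = k + 2 + j := ⟨n - (k + 2), by omega⟩
    induction j with
    | zero =>
      funext c
      simp only [profile, toggle_left, toggle_right]
      have e : profile (toggle k w) k = profile w k :=
        profile_congr fun l hl => toggle_of_ne w (by omega) (by omega)
      rw [e]
      split_ifs <;> omega
    | succ j ih =>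
      funext c
      rw [← add_assoc, profile, profile, ih (by omega) (by omega),
        toggle_of_ne _ (by omega) (by omega)]

/-- Adding a box changes the profile on its own diagonal only, so two boxes whose contents differ by
at least 2 can be added in either order. -/
theorem IsPath.isPath_toggle {n k : ℕ} {w : ℕ → ℤ} (h : IsPath n w) (hk : k + 2 ≤ n) :
    IsPath n (toggle k w) := by
  by_cases hc : |w k - w (k + 1)| ≤ 1
  · have : toggle k w = w := if_pos hc
    rwa [this]
  intro l hl
  have h0 := h k (by omega)
  have h1 := h (k + 1) (by omega)
  simp only [LocMin, profile] at h0 h1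
  by_cases h2 : l = k
  · subst h2
    rw [profile_toggle _ (by omega), toggle_left, if_neg hc]
    refine ⟨?_, ?_⟩ <;> grind
  by_cases h3 : l = k + 1
  · subst h3
    rw [toggle_right, if_neg hc]
    simp only [LocMin, profile, profile_toggle _ (show k ≠ k + 1 by omega), toggle_left, if_neg hc]
    refine ⟨?_, ?_⟩ <;> grind
  rw [profile_toggle _ h3, toggle_of_ne _ h2 h3]
  exact h l hl

theorem IsPath.isPath_prom {N n : ℕ} {w : ℕ → ℤ} (h : IsPath N w) (hn : n < N) :
    IsPath N (prom n w) := by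
  induction n with
  | zero => exact h
  | succ n ih => exact (ih (by omega)).isPath_toggle (by omega)

theorem IsPath.isPath_evac {N n : ℕ} {w : ℕ → ℤ} (h : IsPath N w) (hn : n ≤ N) :
    IsPath N (evac n w) := by
  induction n generalizing w with
  | zero => exact h
  | succ n ih => exact ih (h.isPath_prom (by omega)) (by omega)

theorem IsPath.abs_sub {w : ℕ → ℤ} (h : IsPath 2 w) : |w 0 - w 1| = 1 := by
  have h0 := h 0 (by omega)
  have h1 := h 1 (by omega)
  simp only [LocMin, profile] at h0 h1
  grind

/-- A content can recur only after boxes were added on both adjacent diagonals, hence not within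
three consecutive letters. -/
theorem IsPath.window {n k : ℕ} {w : ℕ → ℤ} (h : IsPath n w) (hk : k + 3 ≤ n) :
    w k ≠ w (k + 1) ∧ w k ≠ w (k + 2) ∧ w (k + 1) ≠ w (k + 2) := by
  have h0 := h k (by omega)
  have h1 := h (k + 1) (by omega)
  have h2 := h (k + 2) (by omega)
  simp only [LocMin, profile] at h0 h1 h2
  generalize profile w k = g at h0 h1 h2
  refine ⟨fun e => ?_, fun e => ?_, fun e => ?_⟩
  · grind
  · grind
  · grind

/-- If a content recurs after three places, the two letters in between are exactly the forced boxes
on the adjacent diagonals. -/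
theorem IsPath.window_four {n k : ℕ} {w : ℕ → ℤ} (h : IsPath n w) (hk : k + 4 ≤ n)
    (e : w k = w (k + 3)) :
    w (k + 1) = w k + 1 ∧ w (k + 2) = w k - 1 ∨ w (k + 1) = w k - 1 ∧ w (k + 2) = w k + 1 := by
  have h0 := h k (by omega)
  have h3 := h (k + 3) (by omega)
  have hw := h.window (show k + 3 ≤ n by omega)
  simp only [LocMin, profile] at h0 h3
  generalize profile w k = g at h0 h3
  grind

/-! ### Elementary Knuth moves -/

/-- `x` lies strictly between `y` and `z`. -/
def Between (x y z : ℤ) : Prop := y < x ∧ x < z ∨ z < x ∧ x < y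

instance (x y z : ℤ) : Decidable (Between x y z) := by unfold Between; infer_instance

/-- The Knuth move on the letters at the places `i`, `i + 1`, `i + 2`: if the first or the last of
them is the median, exchange the other two. -/
def knuth (i : ℕ) (w : ℕ → ℤ) : ℕ → ℤ :=
  if Between (w i) (w (i + 1)) (w (i + 2)) then toggle (i + 1) w
  else if Between (w (i + 2)) (w i) (w (i + 1)) then toggle i w
  else w

theorem IsPath.isPath_knuth {n i : ℕ} {w : ℕ → ℤ} (h : IsPath n w) (hi : i + 3 ≤ n) :
    IsPath n (knuth i w) := by
  unfold knuth
  split_ifs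
  · exact h.isPath_toggle (by omega)
  · exact h.isPath_toggle (by omega)
  · exact h

theorem knuth_of_outside {i k : ℕ} (w : ℕ → ℤ) (h : k < i ∨ i + 2 < k) : knuth i w k = w k := by
  unfold knuth
  split_ifs
  · exact toggle_of_ne _ (by omega) (by omega)
  · exact toggle_of_ne _ (by omega) (by omega)
  · rfl

theorem knuth_toggle {i k : ℕ} (w : ℕ → ℤ) (h : k + 2 ≤ i ∨ i + 3 ≤ k) :
    knuth i (toggle k w) = toggle k (knuth i w) := by
  unfold knuth
  rw [toggle_of_ne w (show i ≠ k by omega) (by omega),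
    toggle_of_ne w (show i + 1 ≠ k by omega) (by omega),
    toggle_of_ne w (show i + 2 ≠ k by omega) (by omega)]
  have e1 : toggle (i + 1) (toggle k w) = toggle k (toggle (i + 1) w) := by
    rcases h with h | h
    · exact (toggle_comm (by omega) w).symm
    · exact toggle_comm (by omega) w
  have e2 : toggle i (toggle k w) = toggle k (toggle i w) := by
    rcases h with h | h
    · exact (toggle_comm (by omega) w).symm
    · exact toggle_comm (by omega) w
  split_ifs
  · exact e1
  · exact e2
  · rfl

theorem revCompl_knuth (t : ℤ) {n i j : ℕ} (h : i + j + 3 = n) (w : ℕ → ℤ) :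
    revCompl t n (knuth i w) = knuth j (revCompl t n w) := by
  have e1 : revCompl t n w j = t - w (i + 2) := by
    unfold revCompl
    rw [if_pos (by omega), show n - 1 - j = i + 2 by omega]
  have e2 : revCompl t n w (j + 1) = t - w (i + 1) := by
    unfold revCompl
    rw [if_pos (by omega), show n - 1 - (j + 1) = i + 1 by omega]
  have e3 : revCompl t n w (j + 2) = t - w i := by
    unfold revCompl
    rw [if_pos (by omega), show n - 1 - (j + 2) = i by omega]
  have t1 := revCompl_toggle t (show i + 1 + j + 2 = n by omega) w
  have t2 := revCompl_toggle t (show i + (j + 1) + 2 = n by omega) w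
  unfold knuth
  rw [e1, e2, e3]
  have b1 : Between (w i) (w (i + 1)) (w (i + 2)) ↔
      Between (t - w i) (t - w (i + 2)) (t - w (i + 1)) := by unfold Between; omega
  have b2 : Between (w (i + 2)) (w i) (w (i + 1)) ↔
      Between (t - w (i + 2)) (t - w (i + 1)) (t - w i) := by unfold Between; omega
  have b3 : Between (w i) (w (i + 1)) (w (i + 2)) → ¬ Between (w (i + 2)) (w i) (w (i + 1)) := by
    unfold Between; omega
  simp only [← b1, ← b2]
  by_cases c1 : Between (w i) (w (i + 1)) (w (i + 2))
  · rw [if_pos c1, if_neg (b3 c1), if_pos c1, t1]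
  · rw [if_neg c1, if_neg c1]
    split_ifs
    · exact t2
    · rfl

theorem knuth_left (i : ℕ) (w : ℕ → ℤ) : knuth i w i =
    if Between (w (i + 2)) (w i) (w (i + 1)) then w (i + 1) else w i := by
  unfold knuth
  split_ifs with h1 h2 h2
  · unfold Between at h1 h2; omega
  · exact toggle_of_ne _ (by omega) (by omega)
  · rw [toggle_left, if_neg]
    unfold Between at h2; grind
  · rfl

theorem knuth_middle (i : ℕ) (w : ℕ → ℤ) : knuth i w (i + 1) =
    if Between (w i) (w (i + 1)) (w (i + 2)) then w (i + 2)
    else if Between (w (i + 2)) (w i) (w (i + 1)) then w i else w (i + 1) := by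
  unfold knuth
  split_ifs with h1 h2
  · rw [toggle_left, if_neg]
    unfold Between at h1; grind
  · rw [toggle_right, if_neg]
    unfold Between at h2; grind
  · rfl

theorem knuth_right (i : ℕ) (w : ℕ → ℤ) : knuth i w (i + 2) =
    if Between (w i) (w (i + 1)) (w (i + 2)) then w (i + 1) else w (i + 2) := by
  unfold knuth
  split_ifs with h1 h2
  · rw [toggle_right, if_neg]
    unfold Between at h1; grind
  · exact toggle_of_ne _ (by omega) (by omega)
  · rfl

/-! ### A letter passing a Knuth move -/

/-- A letter `x` moves past the letter `a`: what stays behind. -/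
def passOut (x a : ℤ) : ℤ := if |x - a| ≤ 1 then x else a

/-- A letter `x` moves past the letter `a`: what moves on. -/
def passOn (x a : ℤ) : ℤ := if |x - a| ≤ 1 then a else x

theorem pass_cases (x a : ℤ) : (a ≤ x + 1 ∧ x ≤ a + 1 ∧ passOut x a = x ∧ passOn x a = a) ∨
    ((x + 1 < a ∨ a + 1 < x) ∧ passOut x a = a ∧ passOn x a = x) := by
  unfold passOn passOut
  split_ifs with h
  · rw [abs_le] at h; left; omega
  · right
    refine ⟨?_, rfl, rfl⟩
    by_contra hc
    exact h (abs_le.2 (by omega))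


theorem pass_of_near {x a : ℤ} (h1 : a ≤ x + 1) (h2 : x ≤ a + 1) :
    passOut x a = x ∧ passOn x a = a := by
  rcases pass_cases x a with h | h <;> omega

theorem pass_of_far {x a : ℤ} (h : x + 1 < a ∨ a + 1 < x) :
    passOut x a = a ∧ passOn x a = x := by
  rcases pass_cases x a with h | h <;> omega

theorem pass_knuth_left {x a b c : ℤ} (h1 : x ≠ a) (h2 : x ≠ b) (h3 : x ≠ c) (m : Between a b c) :
    ∃ p q r f, Between p q r ∧
      (passOut x a = p ∧ passOut (passOn x a) b = q ∧ passOut (passOn (passOn x a) b) c = r ∧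
        passOn (passOn (passOn x a) b) c = f) ∧
      (passOut x a = p ∧ passOut (passOn x a) c = r ∧ passOut (passOn (passOn x a) c) b = q ∧
        passOn (passOn (passOn x a) c) b = f) := by
  have f1 := pass_cases x a
  unfold Between at *
  rcases f1 with ⟨n1, n2, o1, o2⟩ | ⟨n, o1, o2⟩
  · rw [o1, o2]
    have f2 := pass_cases a b
    have f3 := pass_cases a c
    rcases f2 with ⟨k1, k2, p1, p2⟩ | ⟨k, p1, p2⟩
    · rw [p1, p2, (pass_of_far (x := b) (a := c) (by omega)).1,
        (pass_of_far (x := b) (a := c) (by omega)).2]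
      rcases f3 with ⟨j1, j2, q1, q2⟩ | ⟨j, q1, q2⟩
      · omega
      · rw [q1, q2, p1, p2]
        exact ⟨x, a, c, b, by omega, ⟨rfl, rfl, rfl, rfl⟩, rfl, rfl, rfl, rfl⟩
    · rw [p1, p2]
      rcases f3 with ⟨j1, j2, q1, q2⟩ | ⟨j, q1, q2⟩
      · rw [q1, q2, (pass_of_far (x := c) (a := b) (by omega)).1,
          (pass_of_far (x := c) (a := b) (by omega)).2]
        exact ⟨x, b, a, c, by omega, ⟨rfl, rfl, rfl, rfl⟩, rfl, rfl, rfl, rfl⟩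
      · rw [q1, q2, p1, p2]
        exact ⟨x, b, c, a, by omega, ⟨rfl, rfl, rfl, rfl⟩, rfl, rfl, rfl, rfl⟩
  · rw [o1, o2]
    have f2 := pass_cases x b
    have f3 := pass_cases x c
    rcases f2 with ⟨k1, k2, p1, p2⟩ | ⟨k, p1, p2⟩
    · rw [p1, p2, (pass_of_far (x := b) (a := c) (by omega)).1,
        (pass_of_far (x := b) (a := c) (by omega)).2]
      rcases f3 with ⟨j1, j2, q1, q2⟩ | ⟨j, q1, q2⟩
      · omega
      · rw [q1, q2, p1, p2]
        exact ⟨a, x, c, b, by omega, ⟨rfl, rfl, rfl, rfl⟩, rfl, rfl, rfl, rfl⟩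
    · rw [p1, p2]
      rcases f3 with ⟨j1, j2, q1, q2⟩ | ⟨j, q1, q2⟩
      · rw [q1, q2, (pass_of_far (x := c) (a := b) (by omega)).1,
          (pass_of_far (x := c) (a := b) (by omega)).2]
        exact ⟨a, b, x, c, by omega, ⟨rfl, rfl, rfl, rfl⟩, rfl, rfl, rfl, rfl⟩
      · rw [q1, q2, p1, p2]
        exact ⟨a, b, c, x, by omega, ⟨rfl, rfl, rfl, rfl⟩, rfl, rfl, rfl, rfl⟩

/-- When the last letter is the median, the kind of move is preserved except if `x = c`: then `a`
and `b` are the two contents adjacent to `x`, and the letters left behind have their median first.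
This is the reason for the two alternatives. -/
theorem pass_knuth_right {x a b c : ℤ} (h1 : x ≠ a) (h2 : x ≠ b)
    (h3 : x = c → a = x + 1 ∧ b = x - 1 ∨ a = x - 1 ∧ b = x + 1) (m : Between c a b) :
    ∃ p q r f, (passOut x a = p ∧ passOut (passOn x a) b = q ∧
        passOut (passOn (passOn x a) b) c = r ∧ passOn (passOn (passOn x a) b) c = f) ∧
      ((Between r p q ∧ passOut x b = q ∧ passOut (passOn x b) a = p ∧
        passOut (passOn (passOn x b) a) c = r ∧ passOn (passOn (passOn x b) a) c = f) ∨
      (Between p q r ∧ passOut x b = p ∧ passOut (passOn x b) a = r ∧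
        passOut (passOn (passOn x b) a) c = q ∧ passOn (passOn (passOn x b) a) c = f)) := by
  by_cases hc : x = c
  · subst hc
    rw [(pass_of_near (x := x) (a := a) (by omega) (by omega)).1,
      (pass_of_near (x := x) (a := a) (by omega) (by omega)).2,
      (pass_of_near (x := x) (a := b) (by omega) (by omega)).1,
      (pass_of_near (x := x) (a := b) (by omega) (by omega)).2,
      (pass_of_far (x := a) (a := b) (by omega)).1,
      (pass_of_far (x := a) (a := b) (by omega)).2,
      (pass_of_far (x := b) (a := a) (by omega)).1,
      (pass_of_far (x := b) (a := a) (by omega)).2,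
      (pass_of_near (x := a) (a := x) (by omega) (by omega)).1,
      (pass_of_near (x := a) (a := x) (by omega) (by omega)).2,
      (pass_of_near (x := b) (a := x) (by omega) (by omega)).1,
      (pass_of_near (x := b) (a := x) (by omega) (by omega)).2]
    exact ⟨x, b, a, x, ⟨rfl, rfl, rfl, rfl⟩, Or.inr
      ⟨by unfold Between at *; omega, rfl, rfl, rfl, rfl⟩⟩
  unfold Between at *
  rcases pass_cases x a with ⟨n1, n2, o1, o2⟩ | ⟨n, o1, o2⟩
  · rw [o1, o2, (pass_of_far (x := x) (a := b) (by omega)).1,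
      (pass_of_far (x := x) (a := b) (by omega)).2, o1, o2,
      (pass_of_far (x := a) (a := b) (by omega)).1,
      (pass_of_far (x := a) (a := b) (by omega)).2]
    refine ⟨x, b, _, _, ⟨rfl, rfl, rfl, rfl⟩, Or.inl ⟨?_, rfl, rfl, rfl, rfl⟩⟩
    rcases pass_cases a c with h | h <;> omega
  · rw [o1, o2]
    rcases pass_cases x b with ⟨k1, k2, p1, p2⟩ | ⟨k, p1, p2⟩
    · rw [p1, p2, (pass_of_far (x := b) (a := a) (by omega)).1,
        (pass_of_far (x := b) (a := a) (by omega)).2]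
      refine ⟨a, x, _, _, ⟨rfl, rfl, rfl, rfl⟩, Or.inl ⟨?_, rfl, rfl, rfl, rfl⟩⟩
      rcases pass_cases b c with h | h <;> omega
    · rw [p1, p2, o1, o2]
      refine ⟨a, b, _, _, ⟨rfl, rfl, rfl, rfl⟩, Or.inl ⟨?_, rfl, rfl, rfl, rfl⟩⟩
      rcases pass_cases x c with h | h <;> omega

/-- Passing a letter preserves ascents. -/
theorem pass_lt {x a b : ℤ} (h1 : x ≠ a) (h2 : x ≠ b) (h3 : a ≠ b) :
    passOut x a < passOut (passOn x a) b ↔ a < b := by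
  rcases pass_cases x a with ⟨n1, n2, o1, o2⟩ | ⟨n, o1, o2⟩
  · rw [o1, o2]
    rcases pass_cases a b with h | h <;> omega
  · rw [o1, o2]
    rcases pass_cases x b with h | h <;> omega

theorem pass_ne {x a b : ℤ} (h1 : x ≠ a) (h2 : x ≠ b) (h3 : a ≠ b) :
    passOut x a ≠ passOut (passOn x a) b := by
  rcases pass_cases x a with ⟨n1, n2, o1, o2⟩ | ⟨n, o1, o2⟩
  · rw [o1, o2]
    rcases pass_cases a b with h | h <;> omega
  · rw [o1, o2]
    rcases pass_cases x b with h | h <;> omega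

/-- The four letter computation behind the compatibility of slides and Knuth moves. -/
theorem pass_knuth {x a b c : ℤ} (h1 : x ≠ a) (h2 : x ≠ b) (h3 : a ≠ b) (h4 : a ≠ c) (h5 : b ≠ c)
    (h6 : x = c → a = x + 1 ∧ b = x - 1 ∨ a = x - 1 ∧ b = x + 1)
    {a' b' c' y z y' z' p q r : ℤ}
    (ha : a' = if Between c a b then b else a)
    (hb : b' = if Between a b c then c else if Between c a b then a else b)
    (hc : c' = if Between a b c then b else c)
    (hy : y = passOn x a) (hz : z = passOn y b) (hy' : y' = passOn x a') (hz' : z' = passOn y' b')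
    (hp : p = passOut x a) (hq : q = passOut y b) (hr : r = passOut z c) :
    passOut x a' = (if Between r p q then q else p) ∧
    passOut y' b' = (if Between p q r then r else if Between r p q then p else q) ∧
    passOut z' c' = (if Between p q r then q else r) ∧
    passOn z' c' = passOn z c := by
  have excl : ∀ p q r, Between p q r → ¬ Between r p q := by unfold Between; omega
  by_cases m1 : Between a b c
  · rw [if_neg (excl _ _ _ m1)] at ha
    rw [if_pos m1] at hb hc
    subst ha hb hc hy' hz'
    obtain ⟨p0, q0, r0, f0, m, ⟨e1, e2, e3, e4⟩, e1', e2', e3', e4'⟩ :=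
      pass_knuth_left h1 h2 (by unfold Between at m1; omega) m1
    subst hy hz hp hq hr
    rw [e1, e2, e3, if_neg (excl _ _ _ m), if_pos m, if_pos m]
    exact ⟨rfl, e2', e3', e4'.trans e4.symm⟩
  rw [if_neg m1] at hb hc
  by_cases m2 : Between c a b
  · rw [if_pos m2] at ha hb
    subst ha hb hc hy' hz'
    obtain ⟨p0, q0, r0, f0, ⟨e1, e2, e3, e4⟩, ⟨m, e1', e2', e3', e4'⟩ | ⟨m, e1', e2', e3', e4'⟩⟩ :=
      pass_knuth_right h1 h2 h6 m2
    · subst hy hz hp hq hr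
      rw [e1, e2, e3, if_pos m, if_neg fun h => excl _ _ _ h m, if_pos m,
        if_neg fun h => excl _ _ _ h m]
      exact ⟨e1', e2', e3', e4'.trans e4.symm⟩
    · subst hy hz hp hq hr
      rw [e1, e2, e3, if_neg (excl _ _ _ m), if_pos m, if_pos m]
      exact ⟨e1', e2', e3', e4'.trans e4.symm⟩
  rw [if_neg m2] at ha hb
  subst ha hb hc hy' hz' hy
  -- No Knuth move applies, so `b` is the median; `x = c` would make `c` the median instead. By
  -- `pass_lt` the letters left behind are again monotone, and no Knuth move applies to them either.
  have hxc : x ≠ c' := fun h => by unfold Between at m1 m2; omega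
  have hyb : passOn x a' ≠ b' ∧ passOn x a' ≠ c' := by
    rcases pass_cases x a' with h | h <;> omega
  have l1 := pass_lt h1 h2 h3
  have l2 := pass_lt hyb.1 hyb.2 h5
  have n1 := pass_ne h1 h2 h3
  have n2 := pass_ne hyb.1 hyb.2 h5
  rw [← hp, ← hq] at l1 n1
  rw [← hz, ← hq, ← hr] at l2 n2
  have m3 : ¬ Between p q r := by unfold Between at *; omega
  have m4 : ¬ Between r p q := by unfold Between at *; omega
  rw [if_neg m3, if_neg m4, if_neg m4, if_neg m3, ← hp, ← hq, ← hz, ← hr]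
  exact ⟨rfl, rfl, rfl, rfl⟩

/-- Three successive toggles carry the letter at place `i` past the next three; this translates them
into `passOut` and `passOn`. -/
theorem toggle_three (i : ℕ) (w : ℕ → ℤ) :
    let u := toggle (i + 2) (toggle (i + 1) (toggle i w))
    let y := passOn (w i) (w (i + 1))
    let z := passOn y (w (i + 2))
    u i = passOut (w i) (w (i + 1)) ∧ u (i + 1) = passOut y (w (i + 2)) ∧
      u (i + 2) = passOut z (w (i + 3)) ∧ u (i + 3) = passOn z (w (i + 3)) := by
  have e1 : toggle i w (i + 2) = w (i + 2) := toggle_of_ne _ (by omega) (by omega)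
  have e2 : toggle i w (i + 3) = w (i + 3) := toggle_of_ne _ (by omega) (by omega)
  have e3 : toggle i w (i + 1) = passOn (w i) (w (i + 1)) := toggle_right _ _
  have e4 : toggle (i + 1) (toggle i w) (i + 3) = w (i + 3) :=
    (toggle_of_ne _ (by omega) (by omega)).trans e2
  have e5 : toggle (i + 1) (toggle i w) (i + 2) =
      passOn (passOn (w i) (w (i + 1))) (w (i + 2)) := by
    rw [show i + 2 = i + 1 + 1 from rfl, toggle_right, e3]
    rw [show i + 1 + 1 = i + 2 from rfl, e1]
    rfl
  refine ⟨?_, ?_, ?_, ?_⟩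
  · rw [toggle_of_ne _ (by omega) (by omega), toggle_of_ne _ (by omega) (by omega)]
    exact toggle_left _ _
  · rw [toggle_of_ne _ (by omega) (by omega), toggle_left, e3]
    rw [show i + 1 + 1 = i + 2 from rfl, e1]
    rfl
  · rw [toggle_left, e5]
    rw [show i + 2 + 1 = i + 3 from rfl, e4]
    rfl
  · rw [show i + 3 = i + 2 + 1 from rfl, toggle_right, e5]
    rw [show i + 2 + 1 = i + 3 from rfl, e4]
    rfl

/-- Moving a letter past a Knuth move. -/
theorem toggle_toggle_toggle_knuth {n i : ℕ} {w : ℕ → ℤ} (h : IsPath n w) (hi : i + 4 ≤ n) :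
    toggle (i + 2) (toggle (i + 1) (toggle i (knuth (i + 1) w))) =
      knuth i (toggle (i + 2) (toggle (i + 1) (toggle i w))) := by
  have w1 := h.window (show i + 3 ≤ n by omega)
  have w2 := h.window (show i + 1 + 3 ≤ n by omega)
  have w3 := h.window_four hi
  obtain ⟨u1, u2, u3, u4⟩ := toggle_three i w
  obtain ⟨v1, v2, v3, v4⟩ := toggle_three i (knuth (i + 1) w)
  have k0 : knuth (i + 1) w i = w i := knuth_of_outside _ (by omega)
  have k1 := knuth_left (i + 1) w
  have k2 := knuth_middle (i + 1) w
  have k3 := knuth_right (i + 1) w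
  simp only [add_assoc, Nat.reduceAdd] at w1 w2 w3 k1 k2 k3
  have key := pass_knuth w1.1 w1.2.1 w2.1 w2.2.1 w2.2.2 w3
    k1 k2 k3 rfl rfl rfl rfl rfl rfl rfl
  rw [k0] at v1 v2 v3 v4
  simp only [← u1, ← u2, ← u3, ← u4, ← v1, ← v2, ← v3, ← v4] at key
  funext k
  by_cases c0 : k = i
  · rw [c0, knuth_left]; exact key.1
  by_cases c1 : k = i + 1
  · rw [c1, knuth_middle]; exact key.2.1
  by_cases c2 : k = i + 2
  · rw [c2, knuth_right]; exact key.2.2.1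
  by_cases c3 : k = i + 3
  · rw [c3, knuth_of_outside _ (by omega)]; exact key.2.2.2
  rw [knuth_of_outside _ (by omega)]
  simp only [toggle_of_ne _ (show k ≠ i + 2 by omega) (show k ≠ i + 2 + 1 by omega),
    toggle_of_ne _ (show k ≠ i + 1 by omega) (show k ≠ i + 1 + 1 by omega),
    toggle_of_ne _ (show k ≠ i by omega) (show k ≠ i + 1 by omega)]
  exact knuth_of_outside _ (by omega)

/-- A path starts with 0 and then 1 or -1; the third box either continues in the same direction or
lies on the opposite side of the main diagonal. -/
theorem IsPath.abs_sub_or_between {w : ℕ → ℤ} (h : IsPath 3 w) :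
    |w 1 - w 2| ≤ 1 ∨ Between (w 0) (w 1) (w 2) := by
  have h0 := h 0 (by omega)
  have h1 := h 1 (by omega)
  have h2 := h 2 (by omega)
  simp only [LocMin, profile] at h0 h1 h2
  have e0 : w 0 = 0 := by clear h1 h2 h; grind
  rw [e0] at h1 h2 ⊢
  have e1 : w 1 = 1 ∨ w 1 = -1 := by clear h h0 h2; grind
  have e2 : w 2 = w 1 + w 1 ∨ w 2 = - w 1 := by
    clear h h0 h1
    rcases e1 with e1 | e1 <;> rw [e1] at h2 ⊢ <;> grind
  unfold Between
  rcases e1 with e1 | e1 <;> rw [e1] at e2 ⊢ <;> rcases e2 with e2 | e2 <;> rw [e2] <;> norm_num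

/-! ### Knuth moves under promotion and evacuation -/

theorem knuth_prom_of_le {i n : ℕ} (w : ℕ → ℤ) (h : n + 1 ≤ i) :
    prom n (knuth i w) = knuth i (prom n w) := by
  induction n with
  | zero => rfl
  | succ n ih =>
    rw [prom_succ, prom_succ, ih (by omega), knuth_toggle _ (by omega)]

/-- Promotion commutes with Knuth moves. -/
theorem IsPath.prom_knuth {n i : ℕ} {w : ℕ → ℤ} (h : IsPath (n + 1) w) (hi : i + 3 ≤ n) :
    prom n (knuth (i + 1) w) = knuth i (prom n w) := by
  obtain ⟨j, rfl⟩ := Nat.exists_eq_add_of_le hi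
  clear hi
  induction j with
  | zero =>
    -- The toggles below `i` do not touch the three letters of the move; the toggles `i`, `i + 1`,
    -- `i + 2` carry one letter past them. Later toggles, treated by the induction, are disjoint
    -- from the shifted move.
    simp only [add_zero, prom_succ] at h ⊢
    rw [knuth_prom_of_le _ le_rfl]
    exact toggle_toggle_toggle_knuth (h.isPath_prom (by omega)) (by omega)
  | succ j ih =>
    rw [← add_assoc, prom_succ, prom_succ, ih (h.mono (by omega)), knuth_toggle _ (by omega)]

/-- Evacuation reverses the positions of Knuth moves. -/
theorem IsPath.evac_knuth {n i j : ℕ} {w : ℕ → ℤ} (h : IsPath n w) (hn : i + j + 3 = n) :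
    evac n (knuth i w) = knuth j (evac n w) := by
  induction n generalizing i j w with
  | zero => omega
  | succ n ih =>
    rcases i with _ | i
    · rcases j with _ | j
      · obtain rfl : n = 2 := by omega
        -- On paths `toggle 0` is trivial, since the first two contents differ by 1. So for three
        -- letters evacuation is `toggle 1`, and so is the Knuth move.
        have h01 := (h.mono (show 2 ≤ 3 by omega)).abs_sub
        have hw := h.window (show 0 + 3 ≤ 3 by omega)
        have key : ∀ u : ℕ → ℤ, evac 3 u = toggle 0 (toggle 1 (toggle 0 u)) := fun u => rfl
        have t0 : ∀ u : ℕ → ℤ, |u 0 - u 1| ≤ 1 → toggle 0 u = u := fun u hu => if_pos hu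
        have hnot : ¬ Between (w 2) (w 0) (w 1) := by
          unfold Between; grind
        rw [key, key, t0 w h01.le]
        have hk := h.isPath_knuth (show 0 + 3 ≤ 3 by omega)
        rw [t0 _ (hk.mono (show 2 ≤ 3 by omega)).abs_sub.le]
        have h1 := h.isPath_toggle (show 1 + 2 ≤ 3 by omega)
        rw [t0 _ (h1.mono (show 2 ≤ 3 by omega)).abs_sub.le]
        have h2 := hk.isPath_toggle (show 1 + 2 ≤ 3 by omega)
        rw [t0 _ (h2.mono (show 2 ≤ 3 by omega)).abs_sub.le]
        have e0 : toggle 1 w 0 = w 0 := toggle_of_ne _ (by omega) (by omega)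
        have e1 := toggle_left 1 w
        have e2 := toggle_right 1 w
        simp only [zero_add, Nat.reduceAdd] at e1 e2 hw
        unfold knuth
        simp only [zero_add]
        rw [if_neg hnot, e0, e1, e2]
        by_cases hb : Between (w 0) (w 1) (w 2)
        · have : ¬ |w 1 - w 2| ≤ 1 := by unfold Between at hb; grind
          rw [if_pos hb, if_neg this, if_neg this, if_pos]
          unfold Between at *; omega
        · have : |w 1 - w 2| ≤ 1 := (h.abs_sub_or_between).resolve_right hb
          rw [if_neg hb, if_pos this, if_pos this, if_neg hb, if_neg hnot]
      -- A move at the first place is not shifted by promotion. Comparison after `prom n` instead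
      -- shifts the move on the evacuated side, by `prom_evac_succ`.
      · apply (prom n).injective
        rw [prom_evac_succ, ih (j := j) (h.mono (by omega)) (by omega),
          (h.isPath_evac le_rfl).prom_knuth (by omega), prom_evac_succ]
    · rw [evac_succ, h.prom_knuth (by omega), evac_succ]
      exact ih ((h.isPath_prom (by omega)).mono (by omega)) (by omega)

/-! ### Ascents under promotion and evacuation -/

theorem toggle_lt {n i : ℕ} {w : ℕ → ℤ} (h : IsPath n w) (hi : i + 3 ≤ n) :
    toggle (i + 1) (toggle i w) i < toggle (i + 1) (toggle i w) (i + 1) ↔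
      w (i + 1) < w (i + 2) := by
  have hw := h.window hi
  have e1 : toggle i w (i + 2) = w (i + 2) := toggle_of_ne _ (by omega) (by omega)
  have e2 : toggle i w (i + 1) = passOn (w i) (w (i + 1)) := toggle_right _ _
  rw [toggle_of_ne _ (by omega) (by omega), toggle_left (i + 1), toggle_left, e2]
  simp only [add_assoc, Nat.reduceAdd, e1]
  exact pass_lt hw.1 hw.2.1 hw.2.2

theorem prom_of_lt {n k : ℕ} (w : ℕ → ℤ) (h : n < k) : prom n w k = w k := by
  induction n with
  | zero => rfl
  | succ n ih => rw [prom_succ, toggle_of_ne _ (by omega) (by omega), ih (by omega)]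

theorem IsPath.prom_lt {n i : ℕ} {w : ℕ → ℤ} (h : IsPath (n + 1) w) (hi : i + 2 ≤ n) :
    prom n w i < prom n w (i + 1) ↔ w (i + 1) < w (i + 2) := by
  obtain ⟨j, rfl⟩ := Nat.exists_eq_add_of_le hi
  clear hi
  induction j with
  | zero =>
    simp only [add_zero, prom_succ] at h ⊢
    rw [toggle_lt (h.isPath_prom (by omega)) (by omega), prom_of_lt _ (by omega), prom_of_lt _ (by omega)]
  | succ j ih =>
    rw [← add_assoc, prom_succ, toggle_of_ne _ (by omega) (by omega),
      toggle_of_ne _ (by omega) (by omega), ih (h.mono (by omega))]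

/-- Evacuation reverses the positions of ascents. -/
theorem IsPath.evac_lt {n i j : ℕ} {w : ℕ → ℤ} (h : IsPath n w) (hn : i + j + 2 = n) :
    evac n w j < evac n w (j + 1) ↔ w i < w (i + 1) := by
  induction n generalizing i j w with
  | zero => omega
  | succ n ih =>
    rcases i with _ | i
    · rcases j with _ | j
      · obtain rfl : n = 1 := by omega
        have : evac 2 w = w := if_pos h.abs_sub.le
        rw [this]
      · rw [← ih (i := 0) (j := j) (h.mono (by omega)) (by omega), ← prom_evac_succ n,
          (h.isPath_evac le_rfl).prom_lt (by omega)]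
    · rw [evac_succ, ih (i := i) ((h.isPath_prom (by omega)).mono (by omega)) (by omega),
        h.prom_lt (by omega)]

end ContentWord

namespace ContentWord

/-! ### Paths with the same profile are connected by Knuth moves -/

theorem profile_succ (w : ℕ → ℤ) (n : ℕ) (c : ℤ) :
    profile w (n + 1) c = profile w n c + if c = w n then 2 else 0 := rfl

theorem profile_knuth {i n : ℕ} (w : ℕ → ℤ) (h : i + 3 ≤ n) :
    profile (knuth i w) n = profile w n := by
  unfold knuth
  split_ifs
  · exact profile_toggle _ (by omega)
  · exact profile_toggle _ (by omega)
  · rfl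

theorem IsPath.profile_step {n : ℕ} {w : ℕ → ℤ} (h : IsPath n w) (c : ℤ) :
    profile w n (c + 1) = profile w n c + 1 ∨ profile w n (c + 1) = profile w n c - 1 := by
  induction n with
  | zero => simp only [profile]; grind
  | succ n ih =>
    have h1 := ih (h.mono (by omega))
    obtain ⟨h2, h3⟩ := h n (by omega)
    simp only [profile]
    by_cases e1 : c = w n
    · subst e1
      grind
    by_cases e2 : c + 1 = w n
    · obtain rfl : c = w n - 1 := by omega
      rw [sub_add_cancel] at *
      grind
    · simpa [e1, e2] using h1

/-- Between a rise and a fall there is a local maximum. -/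
theorem exists_locMax {h : ℤ → ℤ} (hs : ∀ c, h (c + 1) = h c + 1 ∨ h (c + 1) = h c - 1) {p q : ℤ}
    (hp : h (p + 1) = h p + 1) (hq : h (q - 1) = h q + 1) (hpq : p < q) :
    ∃ t, p < t ∧ t < q ∧ LocMax h t := by
  obtain ⟨k, rfl⟩ : ∃ k : ℕ, q = p + 1 + k := ⟨(q - p - 1).toNat, by omega⟩
  induction k with
  | zero =>
    exfalso
    simp only [Nat.cast_zero, add_zero] at hq
    rw [add_sub_cancel_right] at hq
    omega
  | succ k ih =>
    have e1 : p + 1 + ((k + 1 : ℕ) : ℤ) - 1 = p + 1 + k := by push_cast; ring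
    have e2 : p + 1 + ((k + 1 : ℕ) : ℤ) = p + 1 + k + 1 := by push_cast; ring
    rw [e1, e2] at hq
    rcases hs (p + 1 + k - 1) with h1 | h1
    · rw [sub_add_cancel] at h1
      refine ⟨p + 1 + k, by omega, by omega, ?_, ?_⟩ <;> omega
    · rw [sub_add_cancel] at h1
      by_cases hk : k = 0
      · subst hk
        simp only [Nat.cast_zero, add_zero, add_sub_cancel_right] at h1
        omega
      · obtain ⟨t, h2, h3, h4⟩ := ih (by omega) (by omega)
        exact ⟨t, h2, by omega, h4⟩

theorem locMax_last {n : ℕ} {w : ℕ → ℤ} (h : IsPath (n + 1) w) :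
    LocMax (profile w (n + 1)) (w n) := by
  obtain ⟨h1, h2⟩ := h n (by omega)
  simp only [LocMax, profile]
  grind

/-- Removable boxes never lie on adjacent diagonals, so removing one does not affect the others. -/
theorem LocMax.ne {h : ℤ → ℤ} {p q : ℤ} (hp : LocMax h p) (hq : LocMax h q) :
    p ≠ q + 1 ∧ q ≠ p + 1 := by
  obtain ⟨h1, h2⟩ := hp
  obtain ⟨h3, h4⟩ := hq
  constructor <;> rintro rfl <;> simp only [add_sub_cancel_right] at * <;> omega

/-- Every removable box may be added last. -/
theorem IsPath.exists_remove {n : ℕ} {w : ℕ → ℤ} (h : IsPath n w) {q : ℤ}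
    (hq : LocMax (profile w n) q) :
    ∃ m u, n = m + 1 ∧ IsPath m u ∧ ∀ c, profile u m c = profile w n c - if c = q then 2 else 0 := by
  induction n with
  | zero => simp only [LocMax, profile] at hq; grind
  | succ n ih =>
    by_cases e : q = w n
    · refine ⟨n, w, rfl, h.mono (by omega), fun c => ?_⟩
      simp only [profile, e]
      ring
    have hne := (locMax_last h).ne hq
    have hw := h n (by omega)
    -- Since `q` is neither equal nor adjacent to the last letter, it was removable before that
    -- letter was added. After its removal the last letter is appended again.
    obtain ⟨m, u, rfl, hu, hp⟩ := ih (h.mono (by omega)) (by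
      simp only [LocMax, profile] at hq ⊢
      grind)
    have hcong : ∀ k ≤ m, profile (Function.update u m (w (m + 1))) k = profile u k := fun k hk =>
      profile_congr fun l hl => Function.update_of_ne (by omega) _ _
    refine ⟨m + 1, Function.update u m (w (m + 1)), rfl, ?_, ?_⟩
    · intro k hk
      rw [hcong k (by omega)]
      by_cases hkm : k = m
      · subst hkm
        rw [Function.update_self]
        simp only [LocMin, hp] at hw ⊢
        grind
      · rw [Function.update_of_ne hkm]
        exact hu k (by omega)
    · intro c
      rw [profile_succ, hcong m le_rfl, hp, Function.update_self, profile_succ w (m + 1)]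
      ring

theorem knuth_swap {i : ℕ} {w : ℕ → ℤ} (h : Between (w i) (w (i + 1)) (w (i + 2))) :
    knuth i w = w ∘ Equiv.swap (i + 1) (i + 2) := by
  rw [knuth, if_pos h, toggle, if_neg]
  unfold Between at h
  rw [show i + 1 + 1 = i + 2 from rfl]
  grind

/-- One Knuth move among the first `n` letters. -/
def KnuthStep (n : ℕ) (u v : ℕ → ℤ) : Prop := ∃ i, i + 3 ≤ n ∧ v = knuth i u

theorem KnuthStep.mono {m n : ℕ} (h : m ≤ n) {u v : ℕ → ℤ}
    (huv : Relation.ReflTransGen (KnuthStep m) u v) : Relation.ReflTransGen (KnuthStep n) u v := by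
  induction huv with
  | refl => exact .refl
  | tail _ hs ih =>
    obtain ⟨i, hi, e⟩ := hs
    exact ih.tail ⟨i, hi.trans h, e⟩

/-- Paths with the same profile are connected by Knuth moves. -/
theorem IsPath.knuth_connected {n : ℕ} {w w' : ℕ → ℤ} (h : IsPath n w) (h' : IsPath n w')
    (hp : profile w n = profile w' n) (hout : ∀ k, n ≤ k → w k = w' k) :
    Relation.ReflTransGen (KnuthStep n) w w' := by
  induction n generalizing w w' with
  | zero =>
    obtain rfl : w = w' := funext fun k => hout k (Nat.zero_le k)
    exact Relation.ReflTransGen.refl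
  | succ n ih =>
    by_cases hlast : w n = w' n
    · refine KnuthStep.mono n.le_succ (ih (h.mono n.le_succ) (h'.mono n.le_succ) ?_ ?_)
      · funext c
        have := congrFun hp c
        simp only [profile, hlast] at this
        omega
      · intro k hk
        rcases eq_or_lt_of_le hk with rfl | hk
        · exact hlast
        · exact hout k hk
    -- Both last letters `p` and `q` are removable, and after removing them so is a letter between.
    have hmp := locMax_last h
    have hmq : LocMax (profile w (n + 1)) (w' n) := hp ▸ locMax_last h'
    have hne := hmp.ne hmq
    have hmq' : LocMax (profile w n) (w' n) := by
      simp only [LocMax, profile] at hmq ⊢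
      grind
    obtain ⟨m, u, rfl, hu, hpu⟩ := (h.mono n.le_succ).exists_remove hmq'
    have hpu' : ∀ c, profile u m c =
        profile w (m + 2) c - (if c = w (m + 1) then 2 else 0) - if c = w' (m + 1) then 2 else 0 :=
      fun c => by rw [hpu c, profile_succ w (m + 1)]; ring
    -- With `p` and `q` removed, the outline rises just right of the smaller one and falls just left
    -- of the larger one.
    obtain ⟨t, ht, hmt⟩ : ∃ t, Between t (w (m + 1)) (w' (m + 1)) ∧ LocMax (profile u m) t := by
      simp only [LocMax] at hmp hmq
      rcases lt_or_gt_of_ne hlast with hlt | hlt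
      · obtain ⟨t, h1, h2, h3⟩ := exists_locMax hu.profile_step (p := w (m + 1)) (q := w' (m + 1))
          (by simp only [hpu']; grind) (by simp only [hpu']; grind) hlt
        exact ⟨t, Or.inl ⟨h1, h2⟩, h3⟩
      · obtain ⟨t, h1, h2, h3⟩ := exists_locMax hu.profile_step (p := w' (m + 1)) (q := w (m + 1))
          (by simp only [hpu']; grind) (by simp only [hpu']; grind) hlt
        exact ⟨t, Or.inr ⟨h1, h2⟩, h3⟩
    obtain ⟨m, v, rfl, hv, hpv⟩ := hu.exists_remove hmt
    simp only [add_assoc, Nat.reduceAdd] at *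
    have build : ∀ p q : ℤ, ∃ x : ℕ → ℤ, (∀ k < m, x k = v k) ∧ x m = t ∧ x (m + 1) = q ∧
        x (m + 2) = p ∧ ∀ k, m + 3 ≤ k → x k = w k := fun p q =>
      ⟨fun k => if k < m then v k else if k = m then t else if k = m + 1 then q
        else if k = m + 2 then p else w k, by grind, by grind, by grind, by grind, by grind⟩
    -- The word `x` ends in `t, q, p`; as `t` lies between, one Knuth move turns this into `t, p,
    -- q`. The induction hypothesis connects `w` with `x` (common last letter `p`) and the moved
    -- word with `w'` (common last letter `q`).
    obtain ⟨x, x1, x2, x3, x4, x5⟩ := build (w (m + 2)) (w' (m + 2))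
    have hy := knuth_swap (i := m) (w := x) (by rw [x2, x3, x4]; unfold Between at *; omega)
    have hx0 : profile x m = profile v m := profile_congr x1
    have hxm1 : ∀ c, profile x (m + 1) c = profile u (m + 1) c := fun c => by
      rw [profile_succ, hx0, x2, hpv]; ring
    have hxm2 : ∀ c, profile x (m + 2) c = profile w (m + 2) c := fun c => by
      rw [profile_succ, hxm1, x3, hpu]; ring
    have hxm3 : ∀ c, profile x (m + 3) c = profile w (m + 3) c := fun c => by
      rw [profile_succ, hxm2, x4]; rfl
    have hx : IsPath (m + 3) x := by
      intro k hk
      by_cases k1 : k < m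
      · rw [x1 k k1, profile_congr fun l hl => x1 l (hl.trans k1)]
        exact hv k k1
      simp only [LocMax] at hmp hmq hmq' hmt
      by_cases k2 : k = m
      · subst k2
        simp only [LocMin, hx0, x2, hpv]
        grind
      by_cases k3 : k = m + 1
      · subst k3
        simp only [LocMin, hxm1, x3, hpu]
        grind
      obtain rfl : k = m + 2 := by omega
      simp only [LocMin, hxm2, x4]
      exact h (m + 2) (by omega)
    have hyp : IsPath (m + 3) (knuth m x) := hx.isPath_knuth le_rfl
    have hylast : knuth m x (m + 2) = w' (m + 2) := by rw [hy]; simp [x3]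
    have hyprof : profile (knuth m x) (m + 3) = profile x (m + 3) := profile_knuth _ le_rfl
    have s1 : Relation.ReflTransGen (KnuthStep (m + 3)) w x :=
      KnuthStep.mono (by omega) (ih (h.mono (by omega)) (hx.mono (by omega))
        (funext fun c => (hxm2 c).symm) fun k hk => by
          rcases eq_or_lt_of_le hk with rfl | hk
          · exact x4.symm
          · exact (x5 k hk).symm)
    have s3 : Relation.ReflTransGen (KnuthStep (m + 3)) (knuth m x) w' := by
      refine KnuthStep.mono (by omega) (ih (hyp.mono (by omega)) (h'.mono (by omega)) ?_ ?_)
      · funext c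
        have e1 := congrFun hyprof c
        have e2 := hxm3 c
        have e3 := congrFun hp c
        rw [profile_succ _ (m + 2), hylast] at e1
        rw [profile_succ w' (m + 2)] at e3
        omega
      · intro k hk
        rcases eq_or_lt_of_le hk with rfl | hk
        · exact hylast
        · rw [knuth_of_outside _ (by omega), x5 k hk, hout k hk]
    exact (s1.tail ⟨m, by omega, rfl⟩).trans s3

/-- Whether evacuation is the reverse complement depends only on the profile. -/
theorem IsPath.evac_eq_revCompl {n : ℕ} {w w' : ℕ → ℤ} {t : ℤ} (h : IsPath n w) (h' : IsPath n w')
    (hp : profile w n = profile w' n) (hout : ∀ k, n ≤ k → w k = w' k)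
    (he : evac n w = revCompl t n w) : evac n w' = revCompl t n w' := by
  have hc := h.knuth_connected h' hp hout
  suffices IsPath n w' ∧ evac n w' = revCompl t n w' from this.2
  clear hp hout h'
  induction hc with
  | refl => exact ⟨h, he⟩
  | tail _ hs ih =>
    obtain ⟨i, hi, rfl⟩ := hs
    obtain ⟨h1, h2⟩ := ih
    obtain ⟨j, hj⟩ := Nat.exists_eq_add_of_le hi
    have hij : i + j + 3 = n := by omega
    exact ⟨h1.isPath_knuth hi, by rw [h1.evac_knuth hij, h2, revCompl_knuth _ hij]⟩

end ContentWord

namespace StandardYoungTableau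

open ContentWord

variable {μ : YoungDiagram}

/-! ### The content word of a standard tableau -/

/-- The content of a box. -/
def content (c : ℕ × ℕ) : ℤ := (c.2 : ℤ) - c.1

open Classical in
/-- The contents of the boxes with the entries `1, 2, …`. -/
noncomputable def contentWord (T : StandardYoungTableau μ) (k : ℕ) : ℤ :=
  if h : ∃ c ∈ μ, T.filling c = k + 1 then content h.choose else 0

theorem filling_inj (T : StandardYoungTableau μ) {c c' : ℕ × ℕ} (hc : c ∈ μ) (hc' : c' ∈ μ)
    (h : T.filling c = T.filling c') : c = c' :=
  T.filling_bijOn.injOn hc hc' h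

theorem filling_pos (T : StandardYoungTableau μ) {c : ℕ × ℕ} (hc : c ∈ μ) : 1 ≤ T.filling c :=
  (T.filling_bijOn.mapsTo hc).1

theorem filling_le (T : StandardYoungTableau μ) {c : ℕ × ℕ} (hc : c ∈ μ) :
    T.filling c ≤ μ.card :=
  (T.filling_bijOn.mapsTo hc).2

theorem filling_lt (T : StandardYoungTableau μ) {c c' : ℕ × ℕ} (h : c < c') (hc' : c' ∈ μ) :
    T.filling c < T.filling c' :=
  T.filling_strictMonoOn (μ.up_left_mem h.le.1 h.le.2 hc') hc' h

theorem filling_mono (T : StandardYoungTableau μ) {c c' : ℕ × ℕ} (h : c ≤ c') (hc' : c' ∈ μ) :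
    T.filling c ≤ T.filling c' := by
  rcases h.eq_or_lt with rfl | h
  · exact le_rfl
  · exact (T.filling_lt h hc').le

theorem mem_of_filling_pos (T : StandardYoungTableau μ) {c : ℕ × ℕ} (h : 1 ≤ T.filling c) :
    c ∈ μ := by
  by_contra hc
  rw [T.filling_zeros hc] at h
  omega

theorem exists_box (T : StandardYoungTableau μ) {k : ℕ} (hk : k < μ.card) :
    ∃ c ∈ μ, T.filling c = k + 1 :=
  T.filling_bijOn.surjOn (show k + 1 ∈ Set.Icc 1 μ.card from ⟨by omega, hk⟩)

theorem contentWord_eq (T : StandardYoungTableau μ) {k : ℕ} {c : ℕ × ℕ}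
    (h : T.filling c = k + 1) : T.contentWord k = content c := by
  have hc : c ∈ μ := T.mem_of_filling_pos (by omega)
  have hex : ∃ c ∈ μ, T.filling c = k + 1 := ⟨c, hc, h⟩
  rw [contentWord, dif_pos hex,
    T.filling_inj hex.choose_spec.1 hc (hex.choose_spec.2.trans h.symm)]

theorem contentWord_of_le (T : StandardYoungTableau μ) {k : ℕ} (h : μ.card ≤ k) :
    T.contentWord k = 0 := by
  rw [contentWord, dif_neg]
  rintro ⟨c, hc, e⟩
  have := T.filling_le hc
  omega

theorem lt_or_lt_of_content_eq {c c' : ℕ × ℕ} (h : content c = content c') (hne : c ≠ c') :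
    (c.1 < c'.1 ∧ c.2 < c'.2) ∨ (c'.1 < c.1 ∧ c'.2 < c.2) := by
  have : ¬ (c.1 = c'.1 ∧ c.2 = c'.2) := fun h => hne (Prod.ext h.1 h.2)
  unfold content at h
  omega

/-- Each diagonal is filled from the northwest, so the earlier letters together with a content
determine the next box. -/
theorem contentWord_injective :
    Function.Injective (contentWord : StandardYoungTableau μ → ℕ → ℤ) := by
  intro T T' h
  have key : ∀ k, ∀ c c', T.filling c = k + 1 → T'.filling c' = k + 1 → c = c' := by
    intro k
    induction k using Nat.strong_induction_on with
    | _ k ih =>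
      intro c c' hc hc'
      by_contra hne
      have hcm := T.mem_of_filling_pos (c := c) (by omega)
      have hcm' := T'.mem_of_filling_pos (c := c') (by omega)
      have he : content c = content c' := by
        rw [← T.contentWord_eq hc, ← T'.contentWord_eq hc', h]
      rcases lt_or_lt_of_content_eq he hne with hl | hl
      · have hlt : c < c' := Prod.lt_iff.2 (Or.inl ⟨hl.1, hl.2.le⟩)
        have h1 := T'.filling_lt hlt hcm'
        have h2 := T'.filling_pos hcm
        obtain ⟨b, hb, hb'⟩ := T.exists_box (k := T'.filling c - 1)
          (by have := T'.filling_le hcm; omega)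
        have := ih (T'.filling c - 1) (by omega) b c hb' (by omega)
        subst this
        omega
      · have hlt : c' < c := Prod.lt_iff.2 (Or.inl ⟨hl.1, hl.2.le⟩)
        have h1 := T.filling_lt hlt hcm
        have h2 := T.filling_pos hcm'
        obtain ⟨b, hb, hb'⟩ := T'.exists_box (k := T.filling c' - 1)
          (by have := T.filling_le hcm'; omega)
        have := ih (T.filling c' - 1) (by omega) c' b (by omega) hb'
        subst this
        omega
  refine filling_injective (funext fun c => ?_)
  by_cases hc : c ∈ μ
  · have h1 := T.filling_pos hc
    obtain ⟨b, hb, hb'⟩ := T'.exists_box (k := T.filling c - 1)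
      (by have := T.filling_le hc; omega)
    have := key (T.filling c - 1) c b (by omega) hb'
    subst this
    omega
  · rw [T.filling_zeros hc, T'.filling_zeros hc]

/-- The profile counts along each diagonal up to the first box that is not yet filled. -/
theorem profile_contentWord (T : StandardYoungTableau μ) {k : ℕ} (hk : k ≤ μ.card) {i j : ℕ}
    (hij : (i, j) ∈ μ → k < T.filling (i, j))
    (hp : 0 < i → 0 < j → (i - 1, j - 1) ∈ μ ∧ T.filling (i - 1, j - 1) ≤ k) :
    profile T.contentWord k ((j : ℤ) - i) = i + j := by
  induction k generalizing i j with
  | zero =>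
    have : i = 0 ∨ j = 0 := by
      by_contra hc
      obtain ⟨h1, h2⟩ := hp (by omega) (by omega)
      have := T.filling_pos h1
      omega
    simp only [profile]
    rcases this with rfl | rfl
    · simp
    · simp
  | succ k ih =>
    obtain ⟨⟨i', j'⟩, hb, hbk⟩ := T.exists_box hk
    rw [profile_succ, T.contentWord_eq hbk]
    by_cases hc : (j : ℤ) - i = content (i', j')
    · rw [if_pos hc]
      simp only [content] at hc
      have hlt : i' < i := by
        by_contra hle
        have hle' : (i, j) ≤ (i', j') := ⟨by simp only; omega, by simp only; omega⟩
        have h1 := T.filling_mono hle' hb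
        have h2 := hij (μ.up_left_mem hle'.1 hle'.2 hb)
        omega
      obtain ⟨hm, hle⟩ := hp (by omega) (by omega)
      -- The newest box is the last filled one on its diagonal, hence immediately northwest of the
      -- first unfilled one.
      have heq : i' = i - 1 := by
        by_contra hne
        have : (i', j') < (i - 1, j - 1) :=
          Prod.lt_iff.2 (Or.inl ⟨by simp only; omega, by simp only; omega⟩)
        have := T.filling_lt this hm
        omega
      have h0 := ih (by omega) (i := i') (j := j') (fun _ => by omega) fun h1 h2 => by
        have hlt : (i' - 1, j' - 1) < (i', j') :=
          Prod.lt_iff.2 (Or.inl ⟨by simp only; omega, by simp only; omega⟩)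
        have := T.filling_lt hlt hb
        exact ⟨μ.up_left_mem hlt.le.1 hlt.le.2 hb, by omega⟩
      rw [hc, h0]
      omega
    · rw [if_neg hc, add_zero]
      refine ih (by omega) (fun h => by have := hij h; omega) fun h1 h2 => ?_
      obtain ⟨h3, h4⟩ := hp h1 h2
      refine ⟨h3, ?_⟩
      by_contra h5
      have := T.filling_inj h3 hb (by omega)
      rw [Prod.mk.injEq] at this
      simp only [content] at hc
      omega

/-- When a box `(i, j)` is about to be filled, its eastern and southern neighbours are the first
unfilled places on their diagonals, so the three profile values are `i + j`, `i + j + 1` and `i + j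
+ 1`. -/
theorem isPath_contentWord (T : StandardYoungTableau μ) : IsPath μ.card T.contentWord := by
  intro k hk
  obtain ⟨⟨i, j⟩, hb, hbk⟩ := T.exists_box hk
  have lt : ∀ c, c < (i, j) → c ∈ μ ∧ T.filling c ≤ k := fun c hc => by
    have := T.filling_lt hc hb
    exact ⟨μ.up_left_mem hc.le.1 hc.le.2 hb, by omega⟩
  have gt : ∀ c, (i, j) < c → c ∈ μ → k < T.filling c := fun c hc hm => by
    have := T.filling_lt hc hm
    omega
  have h0 := T.profile_contentWord hk.le (i := i) (j := j) (fun _ => by omega)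
    fun h1 h2 => lt _ (Prod.lt_iff.2 (Or.inl ⟨by simp only; omega, by simp only; omega⟩))
  have h1 := T.profile_contentWord hk.le (i := i) (j := j + 1) (gt _ (lt_east (i, j)))
    fun h1 h2 => lt _ (Prod.lt_iff.2 (Or.inl ⟨by simp only; omega, by simp only; omega⟩))
  have h2 := T.profile_contentWord hk.le (i := i + 1) (j := j) (gt _ (lt_south (i, j)))
    fun h1 h2 => lt _ (Prod.lt_iff.2 (Or.inr ⟨by simp only; omega, by simp only; omega⟩))
  rw [T.contentWord_eq hbk, LocMin]
  simp only [content]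
  rw [h0, show (j : ℤ) - i + 1 = (j + 1 : ℕ) - i by push_cast; ring, h1,
    show (j : ℤ) - i - 1 = j - (i + 1 : ℕ) by push_cast; ring, h2]
  push_cast
  constructor <;> ring

/-- The first box outside `μ` on a diagonal. -/
theorem exists_first_not_mem (μ : YoungDiagram) (c : ℤ) : ∃ i j : ℕ, (j : ℤ) - i = c ∧
    (i, j) ∉ μ ∧ (0 < i → 0 < j → (i - 1, j - 1) ∈ μ) := by
  have hex : ∃ t : ℕ, ((-c).toNat + t, c.toNat + t) ∉ μ := by
    by_contra hall
    push Not at hall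
    have hinj : Function.Injective fun t : ℕ => ((-c).toNat + t, c.toNat + t) := fun a b h => by
      simp only [Prod.mk.injEq] at h
      omega
    exact Set.infinite_range_of_injective hinj
      (μ.cells.finite_toSet.subset (Set.range_subset_iff.2 hall))
  classical
  refine ⟨_, _, ?_, Nat.find_spec hex, ?_⟩
  · push_cast
    omega
  · intro h1 h2
    have hpos : 0 < Nat.find hex := by omega
    have := Nat.find_min hex (Nat.sub_lt hpos one_pos)
    rw [not_not] at this
    convert this using 2 <;> omega

/-- When all boxes are filled, the first unfilled place on a diagonal is the first one outside `μ`,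
which does not depend on the tableau. -/
theorem profile_contentWord_card (T T' : StandardYoungTableau μ) :
    profile T.contentWord μ.card = profile T'.contentWord μ.card := by
  funext c
  obtain ⟨i, j, rfl, h1, h2⟩ := exists_first_not_mem μ c
  rw [T.profile_contentWord le_rfl (fun h => absurd h h1) fun h3 h4 =>
      ⟨h2 h3 h4, T.filling_le (h2 h3 h4)⟩,
    T'.profile_contentWord le_rfl (fun h => absurd h h1) fun h3 h4 =>
      ⟨h2 h3 h4, T'.filling_le (h2 h3 h4)⟩]

/-- Boxes with consecutive entries are neighbours if and only if their contents are close. -/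
theorem neighbour_iff (T : StandardYoungTableau μ) {k : ℕ} {b p : ℕ × ℕ}
    (hb : T.filling b = k + 1) (hp : T.filling p = k + 2) :
    (p = east b ∨ p = south b) ↔ |content b - content p| ≤ 1 := by
  have hbm := T.mem_of_filling_pos (c := b) (by omega)
  have hpm := T.mem_of_filling_pos (c := p) (by omega)
  constructor
  · rintro (rfl | rfl) <;> simp [content, east, south]
  intro h
  rw [abs_le] at h
  have hnle : ¬ p ≤ b := fun hle => by
    have := T.filling_mono hle hbm
    omega
  -- A box strictly between the two would need an entry strictly between `k + 1` and `k + 2`.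
  have hmid : ∀ c, b < c → ¬ c < p := fun c h1 h2 => by
    have h3 := T.filling_lt h2 hpm
    have h4 := T.filling_lt h1 (μ.up_left_mem h2.le.1 h2.le.2 hpm)
    omega
  obtain ⟨b1, b2⟩ := b
  obtain ⟨p1, p2⟩ := p
  have he := hmid _ (lt_east (b1, b2))
  have hs := hmid _ (lt_south (b1, b2))
  simp only [content, east, south, Prod.lt_iff, Prod.le_def, Prod.mk.injEq] at *
  omega

end StandardYoungTableau

namespace StandardYoungTableau

open ContentWord

variable {μ : YoungDiagram}

/-! ### Promotion and evacuation act on content words by toggles -/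

/-- The newly admitted entry `i + 1` exceeds every entry admitted before, so it never wins against
an available move. -/
theorem slideStep_succ_of_ne {i : ℕ} {s : (ℕ × ℕ → ℕ) × (ℕ × ℕ)} (h : slideStep i s ≠ s) :
    slideStep (i + 1) s = slideStep i s := by
  unfold slideStep at *
  simp only at *
  split_ifs at * <;> first | rfl | omega | exact absurd rfl h

theorem slideStep_eq_self_iff {i : ℕ} {s : (ℕ × ℕ → ℕ) × (ℕ × ℕ)} :
    slideStep i s = s ↔
      ¬ (1 ≤ s.1 (east s.2) ∧ s.1 (east s.2) ≤ i) ∧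
        ¬ (1 ≤ s.1 (south s.2) ∧ s.1 (south s.2) ≤ i) := by
  have he : east s.2 ≠ s.2 := (lt_east _).ne'
  have hs : south s.2 ≠ s.2 := (lt_south _).ne'
  unfold slideStep
  simp only
  split_ifs with h1 h2
  · exact iff_of_false (fun h => he (congrArg Prod.snd h)) fun h => h.1 h1.1
  · exact iff_of_false (fun h => hs (congrArg Prod.snd h)) fun h => h.2 h2
  · refine iff_of_true rfl ⟨fun h => ?_, h2⟩
    exact h1 ⟨h, fun h3 => absurd h3 h2⟩

theorem slideStep_slide (T : StandardYoungTableau μ) (i : ℕ) (h : 1 ≤ μ.card) :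
    slideStep i (slide i T.filling) = slide i T.filling := by
  have hst := slide_stuck T i h
  have hz := (slideInv_slide T i h).zeros
  have aux : ∀ c, (slide i T.filling).2 < c →
      ¬ (1 ≤ (slide i T.filling).1 c ∧ (slide i T.filling).1 c ≤ i) := by
    intro c hc h1
    by_cases hm : c ∈ μ
    · have := hst c hm hc
      omega
    · have := hz c hm
      omega
  exact slideStep_eq_self_iff.2 ⟨aux _ (lt_east _), aux _ (lt_south _)⟩

/-- After a slide through `1, …, i` got stuck, there is at most one more move through `i + 1`. -/
theorem SlideInv.step_step {i n : ℕ} {s : (ℕ × ℕ → ℕ) × (ℕ × ℕ)} (h : SlideInv μ i n s)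
    (hs : slideStep i s = s) :
    slideStep (i + 1) (slideStep (i + 1) s) = slideStep (i + 1) s := by
  obtain ⟨f, b⟩ := s
  have aux : ∀ b' c, b < b' → b' < c → f b' = i + 1 →
      ¬ (1 ≤ (f ∘ Equiv.swap b b') c ∧ (f ∘ Equiv.swap b b') c ≤ i + 1) := by
    intro b' c h1 h2 h3
    rw [Function.comp_apply, Equiv.swap_apply_of_ne_of_ne (h1.trans h2).ne' h2.ne']
    rintro ⟨h4, h5⟩
    have hc : c ∈ μ := by
      by_contra hc
      have := h.zeros c hc
      simp only at this
      omega
    have : f b' < f c :=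
      h.mono ⟨μ.up_left_mem h2.le.1 h2.le.2 hc, h1.ne'⟩ ⟨hc, (h1.trans h2).ne'⟩ h2
    omega
  have hs' := slideStep_eq_self_iff.1 hs
  simp only at hs'
  by_cases h1 : slideStep (i + 1) (f, b) = (f, b)
  · rw [h1, h1]
  rw [slideStep_eq_self_iff]
  unfold slideStep at h1 ⊢
  simp only at h1 ⊢
  split_ifs at h1 ⊢ with h2 h3
  · have : f (east b) = i + 1 := by omega
    exact ⟨aux _ _ (lt_east b) (lt_east _) this, aux _ _ (lt_east b) (lt_south _) this⟩
  · have : f (south b) = i + 1 := by omega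
    exact ⟨aux _ _ (lt_south b) (lt_east _) this, aux _ _ (lt_south b) (lt_south _) this⟩
  · exact absurd rfl h1

/-- A slide through `1, …, i + 1` is a slide through `1, …, i` followed by one more step. -/
theorem slide_succ (T : StandardYoungTableau μ) (i : ℕ) (h : 1 ≤ μ.card) :
    slide (i + 1) T.filling = slideStep (i + 1) (slide i T.filling) := by
  set s0 := (Function.update T.filling (0, 0) 0, ((0, 0) : ℕ × ℕ)) with hs0
  have inv : ∀ n, SlideInv μ i n ((slideStep i)^[n] s0) := by
    intro n
    induction n with
    | zero => exact slideInv_zero T i h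
    | succ n ih =>
      rw [Function.iterate_succ_apply']
      exact ih.step
  -- Either both slides agree so far, or the shorter one is stuck and the longer one is ahead by a
  -- single step, after which it is stuck too.
  have key : ∀ n, (slideStep (i + 1))^[n] s0 = (slideStep i)^[n] s0 ∨
      slideStep i ((slideStep i)^[n] s0) = (slideStep i)^[n] s0 ∧
        (slideStep (i + 1))^[n] s0 = slideStep (i + 1) ((slideStep i)^[n] s0) := by
    intro n
    induction n with
    | zero => exact Or.inl rfl
    | succ n ih =>
      rw [Function.iterate_succ_apply', Function.iterate_succ_apply']
      by_cases hst : slideStep i ((slideStep i)^[n] s0) = (slideStep i)^[n] s0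
      · right
        rw [hst]
        refine ⟨hst, ?_⟩
        rcases ih with ih | ⟨-, ih⟩
        · rw [ih]
        · rw [ih]
          exact (inv n).step_step hst
      · left
        rcases ih with ih | ⟨h1, -⟩
        · rw [ih, slideStep_succ_of_ne hst]
        · exact absurd h1 hst
  have hfix := slideStep_slide T i h
  have hn : (slideStep i)^[i + 1] s0 = slide i T.filling := by
    rw [Function.iterate_succ_apply']
    exact hfix
  have hk := key (i + 1)
  rw [hn] at hk
  change slide (i + 1) T.filling = _ ∨ _ ∧ slide (i + 1) T.filling = _ at hk
  rcases hk with hk | hk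
  · rw [← hk]
    exact (slideStep_slide T (i + 1) h).symm
  · exact hk.2

theorem filling_promoteUpTo (T : StandardYoungTableau μ) {i : ℕ} (hi : 1 ≤ i ∧ i ≤ μ.card) :
    (promoteUpTo i T).filling = promoteFilling i T.filling := by
  unfold promoteUpTo
  rw [dif_pos hi]
  rfl

theorem promoteUpTo_one (T : StandardYoungTableau μ) : promoteUpTo 1 T = T := by
  by_cases h : 1 ≤ μ.card
  · refine filling_injective ?_
    rw [filling_promoteUpTo T ⟨le_rfl, h⟩]
    have hI := slideInv_zero T 1 h
    have hs : slide 1 T.filling = (Function.update T.filling (0, 0) 0, (0, 0)) := by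
      change slideStep 1 _ = _
      have aux : ∀ c, ((0, 0) : ℕ × ℕ) < c → ¬ (1 ≤ Function.update T.filling (0, 0) 0 c ∧
          Function.update T.filling (0, 0) 0 c ≤ 1) := by
        rintro c hc ⟨h1, h2⟩
        by_cases hm : c ∈ μ
        · have := (hI.bij.mapsTo ⟨hm, hc.ne'⟩).1
          simp only at this
          omega
        · have := hI.zeros c hm
          simp only at this
          omega
      exact slideStep_eq_self_iff.2 ⟨aux _ (lt_east _), aux _ (lt_south _)⟩
    funext c
    unfold promoteFilling
    rw [hs]
    simp only
    by_cases hc : c = (0, 0)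
    · rw [if_pos hc, hc, T.filling_zero_zero h]
    · rw [if_neg hc, Function.update_of_ne hc]
      split_ifs with h1
      · have : T.filling c ≠ 1 := fun e => hc <| by
          refine T.filling_inj (T.mem_of_filling_pos (by omega)) (zero_mem h) ?_
          rw [e, T.filling_zero_zero h]
        omega
      · rfl
  · unfold promoteUpTo
    rw [dif_neg (by omega)]

/-- Promotion of `1, …, i + 1` exchanges the entries `i` and `i + 1` after promotion of
`1, …, i`, unless their boxes are neighbours. -/
theorem filling_promoteUpTo_succ (T : StandardYoungTableau μ) {i : ℕ} (h1 : 1 ≤ i)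
    (h2 : i + 1 ≤ μ.card) {b p : ℕ × ℕ} (hb : (promoteUpTo i T).filling b = i)
    (hp : (promoteUpTo i T).filling p = i + 1) (c : ℕ × ℕ) :
    (promoteUpTo (i + 1) T).filling c =
      if p = east b ∨ p = south b then (promoteUpTo i T).filling c
      else Equiv.swap i (i + 1) ((promoteUpTo i T).filling c) := by
  have hcard : 1 ≤ μ.card := by omega
  have hI := slideInv_slide T i hcard
  have hfix := slideStep_slide T i hcard
  have hsucc := slide_succ T i hcard
  have hinj := fun c' => (promoteUpTo i T).filling_inj (c := b) (c' := c')
  have hbm := (promoteUpTo i T).mem_of_filling_pos (c := b) (by omega)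
  rw [filling_promoteUpTo T ⟨h1, by omega⟩] at *
  rw [filling_promoteUpTo T ⟨by omega, h2⟩]
  unfold promoteFilling at *
  rw [hsucc]
  generalize slide i T.filling = s at *
  obtain ⟨f, b'⟩ := s
  simp only at *
  obtain rfl : b = b' := hinj _ hbm hI.mem (by rw [hb, if_pos rfl])
  have hpb : p ≠ b := by
    rintro rfl
    rw [hb] at hp
    omega
  have hfp : f p = i + 1 := by
    rw [if_neg hpb] at hp
    split_ifs at hp <;> omega
  have huniq : ∀ c, f c = i + 1 → c = p := by
    intro c hc
    have hm : ∀ c, f c = i + 1 → c ∈ μ ∧ c ≠ b := by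
      refine fun c hc => ⟨?_, ?_⟩
      · by_contra hm
        have := hI.zeros c hm
        simp only at this
        omega
      · rintro rfl
        have := hI.empty
        simp only at this
        omega
    exact hI.bij.injOn (hm c hc) (hm p hfp) (hc.trans hfp.symm)
  have h0 : f b = 0 := hI.empty
  rw [slideStep_eq_self_iff] at hfix
  simp only at hfix
  -- If `p` is a neighbour, the hole moves on to `p`: the entry `i + 1` moves to `b` and drops to
  -- `i`, while `p` receives `i + 1`, so nothing changes. Otherwise the hole stays at `b`, which
  -- receives `i + 1`, while the entry at `p` drops to `i`.
  by_cases hnb : p = east b ∨ p = south b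
  · have hstep : slideStep (i + 1) (f, b) = (f ∘ Equiv.swap b p, p) := by
      unfold slideStep
      simp only
      split_ifs with h3 h4
      · rw [huniq (east b) (by omega)]
      · rw [huniq (south b) (by omega)]
      · exfalso
        rcases hnb with rfl | rfl <;> omega
    rw [hstep, if_pos hnb]
    simp only
    by_cases hcp : c = p
    · rw [hcp, if_pos rfl, if_neg hpb, if_neg (by omega), hfp]
    by_cases hcb : c = b
    · rw [hcb] at hcp ⊢
      simp [hcp, hfp]
    · have hne : f c ≠ i + 1 := fun e => hcp (huniq c e)
      simp only [Function.comp_apply, Equiv.swap_apply_of_ne_of_ne hcb hcp, if_neg hcp, if_neg hcb]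
      split_ifs <;> omega
  · rw [if_neg hnb]
    have hstuck : slideStep (i + 1) (f, b) = (f, b) := by
      rw [slideStep_eq_self_iff]
      simp only
      refine ⟨fun h => hnb (Or.inl (huniq _ ?_).symm), fun h => hnb (Or.inr (huniq _ ?_).symm)⟩ <;>
      omega
    rw [hstuck]
    simp only
    by_cases hcb : c = b
    · simp [hcb]
    rw [if_neg hcb, if_neg hcb]
    by_cases h3 : f c ≤ i
    · rw [if_pos h3, if_pos (by omega), Equiv.swap_apply_of_ne_of_ne (by omega) (by omega)]
    · rw [if_neg h3]
      by_cases h4 : f c = i + 1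
      · rw [if_pos (by omega), h4, Equiv.swap_apply_right]
        rfl
      · rw [if_neg (by omega), Equiv.swap_apply_of_ne_of_ne (by omega) (by omega)]

/-- Each increase of the bound contributes one toggle. The shift by one arises because letters are
counted from 0 and promotion of the entry 1 alone is trivial. -/
theorem contentWord_promoteUpTo_succ (T : StandardYoungTableau μ) {n : ℕ} (h : n + 1 ≤ μ.card) :
    (promoteUpTo (n + 1) T).contentWord = prom n T.contentWord := by
  induction n with
  | zero => rw [promoteUpTo_one, prom_zero]
  | succ n ih =>
    rw [prom_succ, ← ih (by omega)]
    set U := promoteUpTo (n + 1) T with hU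
    set V := promoteUpTo (n + 1 + 1) T with hV
    obtain ⟨b, hbm, hb⟩ := U.exists_box (k := n) (by omega)
    obtain ⟨p, hpm, hp⟩ := U.exists_box (k := n + 1) (by omega)
    have hf : ∀ c, V.filling c = _ := filling_promoteUpTo_succ T (by omega) h hb hp
    rw [← hU] at hf
    have hcond : (p = east b ∨ p = south b) ↔ |U.contentWord n - U.contentWord (n + 1)| ≤ 1 := by
      rw [U.contentWord_eq hb, U.contentWord_eq hp]
      exact U.neighbour_iff hb hp
    unfold toggle
    by_cases hn : p = east b ∨ p = south b
    · rw [if_pos (hcond.1 hn)]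
      congr 1
      refine filling_injective (funext fun c => ?_)
      rw [hf, if_pos hn]
    · rw [if_neg fun h => hn (hcond.2 h)]
      funext k
      by_cases hk : k < μ.card
      · obtain ⟨c, hc, hck⟩ := V.exists_box hk
        rw [V.contentWord_eq hck, Function.comp_apply]
        refine (U.contentWord_eq ?_).symm
        have h1 := hf c
        rw [if_neg hn, hck] at h1
        have h2 : U.filling c = Equiv.swap (n + 1) (n + 1 + 1) (k + 1) := by
          rw [h1, Equiv.swap_apply_self]
        rw [h2]
        rcases eq_or_ne k n with rfl | hkn
        · simp
        rcases eq_or_ne k (n + 1) with rfl | hkn'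
        · simp
        rw [Equiv.swap_apply_of_ne_of_ne (by omega) (by omega),
          Equiv.swap_apply_of_ne_of_ne hkn hkn']
      · rw [Function.comp_apply, Equiv.swap_apply_of_ne_of_ne (by omega) (by omega),
          V.contentWord_of_le (by omega), U.contentWord_of_le (by omega)]

theorem contentWord_evacuateUpTo (T : StandardYoungTableau μ) {n : ℕ} (h : n ≤ μ.card) :
    (evacuateUpTo n T).contentWord = evac n T.contentWord := by
  induction n generalizing T with
  | zero => rfl
  | succ n ih =>
    rw [evacuateUpTo, ih _ (by omega), contentWord_promoteUpTo_succ T h, evac_succ]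

theorem contentWord_promotion_iterate (T : StandardYoungTableau μ) (k : ℕ) :
    (promotion^[k] T).contentWord = (prom (μ.card - 1))^[k] T.contentWord := by
  induction k with
  | zero => rfl
  | succ k ih =>
    rw [Function.iterate_succ_apply', Function.iterate_succ_apply', ← ih]
    -- For the empty diagram `μ.card - 1` is 0 by truncation, and both sides are the identity.
    rcases Nat.eq_zero_or_pos μ.card with h | h
    · rw [h, prom_zero, promotion, promoteUpTo, dif_neg (by omega)]
    · rw [← contentWord_promoteUpTo_succ _ (by omega), Nat.sub_add_cancel h]
      rfl

end StandardYoungTableau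

namespace StandardYoungTableau

open ContentWord

/-! ### Rectangles -/

theorem mem_rectDiagram {d m i j : ℕ} : (i, j) ∈ rectDiagram d m ↔ i < d ∧ j < m := by
  change (i, j) ∈ Finset.range d ×ˢ Finset.range m ↔ _
  simp

theorem card_rectDiagram (d m : ℕ) : (rectDiagram d m).card = d * m := by
  change (Finset.range d ×ˢ Finset.range m).card = _
  simp

/-- Only one rectangular tableau has ascents everywhere except at the multiples of `m`. -/
theorem filling_of_ascents {d m : ℕ} (T : StandardYoungTableau (rectDiagram d m))
    (h : ∀ k, k + 1 < d * m → (k + 1) % m ≠ 0 → T.contentWord k < T.contentWord (k + 1))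
    {r c : ℕ} (hr : r < d) (hc : c < m) : T.filling (r, c) = m * r + c + 1 := by
  have hex := fun k => T.exists_box (k := k)
  rw [card_rectDiagram] at hex
  choose! pos hmem hfill using hex
  have bound : ∀ {r c}, r < d → c < m → m * r + c < d * m := fun {r c} hr hc => by
    have : m * (r + 1) ≤ m * d := Nat.mul_le_mul_left m hr
    rw [Nat.mul_succ, Nat.mul_comm m d] at this
    omega
  have hbox : ∀ k, k < d * m → (pos k).1 < d ∧ (pos k).2 < m := fun k hk =>
    mem_rectDiagram.1 (hmem k hk)
  have col : ∀ i j r, r < d → j + i < m → (pos (m * r + j)).2 + i ≤ (pos (m * r + (j + i))).2 := by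
    intro i j r hr hi
    induction i with
    | zero => exact le_rfl
    | succ i ih =>
      refine le_trans (Nat.succ_le_succ (ih (by omega))) ?_
      set k := m * r + (j + i) with hk
      have hkb : k + 1 < d * m := bound hr hi
      have hasc := h k hkb (by
        rw [hk, add_assoc, Nat.mul_add_mod, Nat.mod_eq_of_lt (by omega)]
        omega)
      rw [T.contentWord_eq (hfill k (by omega)), T.contentWord_eq (hfill (k + 1) hkb)] at hasc
      change (pos k).2 + 1 ≤ (pos (k + 1)).2
      -- If the content increases but the column does not, the next box lies weakly northwest,
      -- although its entry is larger.
      by_contra hle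
      simp only [content] at hasc
      have hle' : pos (k + 1) ≤ pos k := ⟨by omega, by omega⟩
      have := T.filling_mono hle' (hmem k (by omega))
      rw [hfill k (by omega), hfill (k + 1) hkb] at this
      omega
  -- A run of `m` strictly increasing columns within `m` columns must use each once, in order. The
  -- same count down each column then fixes the rows.
  have hcol : ∀ r c, r < d → c < m → (pos (m * r + c)).2 = c := by
    intro r c hr hc
    have h1 := col c 0 r hr (by omega)
    have h2 := col (m - 1 - c) c r hr (by omega)
    have h3 := (hbox _ (bound hr (show c + (m - 1 - c) < m by omega))).2
    rw [zero_add] at h1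
    omega
  have row : ∀ i r, r + i < d → (pos (m * r + c)).1 + i ≤ (pos (m * (r + i) + c)).1 := by
    intro i r hi
    induction i with
    | zero => exact le_rfl
    | succ i ih =>
      refine le_trans (Nat.succ_le_succ (ih (by omega))) ?_
      change (pos (m * (r + i) + c)).1 + 1 ≤ (pos (m * (r + (i + 1)) + c)).1
      by_contra hle
      have e1 := hcol (r + i) c (by omega) hc
      have e2 := hcol (r + (i + 1)) c hi hc
      have hle' : pos (m * (r + (i + 1)) + c) ≤ pos (m * (r + i) + c) := ⟨by omega, by omega⟩
      have h1 := T.filling_mono hle' (hmem _ (bound (by omega) hc))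
      rw [hfill _ (bound hi hc), hfill (m * (r + i) + c) (bound (by omega) hc), ← add_assoc,
        Nat.mul_succ] at h1
      omega
  have hrow : (pos (m * r + c)).1 = r := by
    have h1 := row r 0 (by omega)
    have h2 := row (d - 1 - r) r (by omega)
    have h3 := (hbox _ (bound (show r + (d - 1 - r) < d by omega) hc)).1
    rw [zero_add] at h1
    omega
  have hpos : pos (m * r + c) = (r, c) := Prod.ext hrow (hcol r c hr hc)
  rw [← hpos]
  exact hfill _ (bound hr hc)

/-- The tableau filled row by row. -/
theorem exists_superstandard (d m : ℕ) : ∃ T : StandardYoungTableau (rectDiagram d m),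
    ∀ r c, r < d → c < m → T.filling (r, c) = m * r + c + 1 := by
  have hmem : ∀ c : ℕ × ℕ, c ∈ ((rectDiagram d m).cells : Set (ℕ × ℕ)) ↔ c.1 < d ∧ c.2 < m :=
    fun c => mem_rectDiagram
  let f : ℕ × ℕ → ℕ := fun c => if c.1 < d ∧ c.2 < m then m * c.1 + c.2 + 1 else 0
  have hf : ∀ c : ℕ × ℕ, c.1 < d ∧ c.2 < m → f c = m * c.1 + c.2 + 1 := fun c hc => if_pos hc
  have hm : StrictMonoOn f ((rectDiagram d m).cells : Set (ℕ × ℕ)) := by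
    rintro c hc c' hc' hlt
    rw [hf c ((hmem c).1 hc), hf c' ((hmem c').1 hc')]
    rcases Prod.lt_iff.1 hlt with h | h
    · have := Nat.mul_le_mul_left m (Nat.succ_le_of_lt h.1)
      have := ((hmem c).1 hc).2
      rw [Nat.mul_succ] at *
      omega
    · have := Nat.mul_le_mul_left m h.1
      omega
  have hb : Set.BijOn f ((rectDiagram d m).cells : Set (ℕ × ℕ))
      (Set.Icc 1 (rectDiagram d m).card) := by
    rw [card_rectDiagram]
    refine ⟨?_, ?_, ?_⟩
    · intro c hc
      have hc := (hmem c).1 hc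
      rw [hf c hc]
      have : m * (c.1 + 1) ≤ m * d := Nat.mul_le_mul_left m hc.1
      rw [Nat.mul_succ, Nat.mul_comm m d] at this
      exact ⟨by omega, by omega⟩
    · intro c hc c' hc' he
      have hc := (hmem c).1 hc
      have hc' := (hmem c').1 hc'
      rw [hf c hc, hf c' hc'] at he
      have h1 := congrArg (· % m) (Nat.succ_injective he)
      have h2 := congrArg (· / m) (Nat.succ_injective he)
      have hm : 0 < m := by omega
      simp only [Nat.mul_add_mod, Nat.mod_eq_of_lt hc.2, Nat.mod_eq_of_lt hc'.2] at h1
      simp only [Nat.mul_add_div hm, Nat.div_eq_of_lt hc.2, Nat.div_eq_of_lt hc'.2] at h2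
      exact Prod.ext (by omega) h1
    · rintro k ⟨hk, hk'⟩
      have hm : 0 < m := Nat.pos_of_ne_zero fun e => by simp [e] at hk'; omega
      have hc : (k - 1) / m < d ∧ (k - 1) % m < m :=
        ⟨Nat.div_lt_of_lt_mul (by rw [Nat.mul_comm]; omega), Nat.mod_lt _ hm⟩
      refine ⟨((k - 1) / m, (k - 1) % m), (hmem _).2 hc, ?_⟩
      rw [hf _ hc]
      have := Nat.div_add_mod (k - 1) m
      simp only
      omega
  exact ⟨ofFilling f (fun c hc => if_neg fun h => hc ((hmem c).2 h)) hm hb,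
    fun r c hr hc => hf (r, c) ⟨hr, hc⟩⟩

/-- On rectangular tableaux, evacuation is rotation and complementation. -/
theorem evac_contentWord_rect {d m : ℕ} (T : StandardYoungTableau (rectDiagram d m)) :
    evac (d * m) T.contentWord = revCompl ((m : ℤ) - d) (d * m) T.contentWord := by
  have hcard := card_rectDiagram d m
  obtain ⟨S, hS⟩ := exists_superstandard d m
  have hword : ∀ U : StandardYoungTableau (rectDiagram d m),
      (∀ r c, r < d → c < m → U.filling (r, c) = m * r + c + 1) →
      ∀ r c, r < d → c < m → U.contentWord (m * r + c) = (c : ℤ) - r := fun U hU r c hr hc =>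
    U.contentWord_eq (hU r c hr hc)
  have hdecomp : ∀ k, k < d * m → ∃ r c, r < d ∧ c < m ∧ k = m * r + c := fun k hk =>
    have hm : 0 < m := Nat.pos_of_ne_zero fun e => by simp [e] at hk
    ⟨k / m, k % m, Nat.div_lt_of_lt_mul (by rwa [Nat.mul_comm]), Nat.mod_lt _ hm,
      (Nat.div_add_mod k m).symm⟩
  have hpath := fun U : StandardYoungTableau (rectDiagram d m) => U.isPath_contentWord
  rw [hcard] at hpath
  have hE : ∀ r c, r < d → c < m → S.evacuation.filling (r, c) = m * r + c + 1 := by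
    intro r c hr hc
    refine filling_of_ascents _ (fun k hk hkm => ?_) hr hc
    rw [evacuation, contentWord_evacuateUpTo S le_rfl, hcard]
    obtain ⟨i, hi⟩ : ∃ i, i + k + 2 = d * m := ⟨d * m - (k + 2), by omega⟩
    rw [(hpath S).evac_lt hi]
    obtain ⟨r', c', hr', hc', rfl⟩ := hdecomp i (by omega)
    -- As `m` divides `d * m`, reversing the places preserves the row ends; so the place `i`
    -- corresponding to `k` is not the end of a row, and `S` has an ascent there.
    have hc1 : c' + 1 < m := by
      by_contra hge
      apply hkm
      have hdvd : m ∣ (m * r' + c') + 1 := ⟨r' + 1, by rw [Nat.mul_succ]; omega⟩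
      have hdvd' : m ∣ (m * r' + c') + 1 + (k + 1) := ⟨d, by rw [Nat.mul_comm m d]; omega⟩
      exact Nat.mod_eq_zero_of_dvd ((Nat.dvd_add_right hdvd).1 hdvd')
    rw [hword S hS r' c' hr' hc', add_assoc, hword S hS r' (c' + 1) hr' hc1]
    push_cast
    omega
  have hfix : evac (d * m) S.contentWord = S.contentWord := by
    have h1 := contentWord_evacuateUpTo S (le_refl (rectDiagram d m).card)
    rw [hcard] at h1
    rw [← h1]
    have h2 : evacuateUpTo (d * m) S = S.evacuation := by rw [evacuation, hcard]
    rw [h2]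
    funext k
    by_cases hk : k < d * m
    · obtain ⟨r, c, hr, hc, rfl⟩ := hdecomp k hk
      rw [hword _ hE r c hr hc, hword S hS r c hr hc]
    · rw [contentWord_of_le _ (by omega), contentWord_of_le _ (by omega)]
  -- All content words vanish beyond the last box, so the words of `S` and `T` agree there, and it
  -- suffices to treat `S`.
  refine (hpath S).evac_eq_revCompl (hpath T) (hcard ▸ profile_contentWord_card S T)
    (fun k hk => by rw [contentWord_of_le _ (by omega), contentWord_of_le _ (by omega)]) ?_
  rw [hfix]
  funext k
  unfold revCompl
  split_ifs with hk
  · obtain ⟨r, c, hr, hc, rfl⟩ := hdecomp k hk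
    -- Half-turn rotation takes `(r, c)` to `(d - 1 - r, m - 1 - c)`; the two contents add up to `m
    -- - d`, the constant in `revCompl`.
    have e : d * m - 1 - (m * r + c) = m * (d - 1 - r) + (m - 1 - c) := by
      obtain ⟨a, rfl⟩ : ∃ a, d = a + r + 1 := ⟨d - 1 - r, by omega⟩
      obtain ⟨b, rfl⟩ : ∃ b, m = b + c + 1 := ⟨m - 1 - c, by omega⟩
      rw [show a + r + 1 - 1 - r = a by omega, show b + c + 1 - 1 - c = b by omega,
        Nat.sub_sub]
      refine Nat.sub_eq_of_eq_add ?_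
      ring
    rw [e, hword S hS _ _ hr hc, hword S hS _ _ (by omega) (by omega)]
    omega
  · rfl

/-! ### Half promotion as a conjugate of evacuation -/

variable {μ : YoungDiagram}

theorem evacuateUpTo_involutive {n : ℕ} (h : n ≤ μ.card) :
    Function.Involutive (evacuateUpTo n : StandardYoungTableau μ → StandardYoungTableau μ) :=
  fun T => contentWord_injective <| by
    rw [contentWord_evacuateUpTo _ h, contentWord_evacuateUpTo _ h, evac_evac]

/-- Half of a full promotion cycle of a rectangle is conjugate to evacuation. -/
theorem promotion_iterate_half {d m n : ℕ} (hn : n + n = d * m)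
    (T : StandardYoungTableau (rectDiagram d m)) :
    promotion^[n] T = evacuateUpTo n (evacuation (evacuateUpTo n T)) := by
  have hcard := card_rectDiagram d m
  apply contentWord_injective
  -- The full evacuation of `T` is a `revCompl`, which cancels the inner one; the remaining
  -- `revCompl` is the full evacuation of `evacuateUpTo n T`, again a rectangular tableau.
  rw [contentWord_promotion_iterate, contentWord_evacuateUpTo _ (by omega), evacuation,
    contentWord_evacuateUpTo _ le_rfl, hcard, prom_iterate_half ((m : ℤ) - d) hn,
    evac_contentWord_rect T, revCompl_revCompl, evac_contentWord_rect,
    contentWord_evacuateUpTo _ (by omega)]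

end StandardYoungTableau

theorem corollary3p6 (d m N : ℕ) (hN : N = d * m) (hEven : Even N) :
    Nat.card {T : StandardYoungTableau (rectDiagram d m) // T.evacuation = T} =
        Nat.card {T : StandardYoungTableau (rectDiagram d m) //
          StandardYoungTableau.promotion^[N / 2] T = T} ∧
      (StandardYoungTableau.evacuation ∘ StandardYoungTableau.evacuateUpTo (N / 2) :
          StandardYoungTableau (rectDiagram d m) → StandardYoungTableau (rectDiagram d m)) =
        StandardYoungTableau.evacuateUpTo (N / 2) ∘ StandardYoungTableau.promotion^[N / 2] ∧
      Function.Involutive (StandardYoungTableau.evacuateUpTo (N / 2) :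
          StandardYoungTableau (rectDiagram d m) → StandardYoungTableau (rectDiagram d m)) ∧
      Set.BijOn (StandardYoungTableau.evacuateUpTo (N / 2))
        {T : StandardYoungTableau (rectDiagram d m) | T.evacuation = T}
        {T : StandardYoungTableau (rectDiagram d m) |
          StandardYoungTableau.promotion^[N / 2] T = T} := by
  obtain ⟨n, hn⟩ := hEven
  have hcard := StandardYoungTableau.card_rectDiagram d m
  have hhalf : N / 2 = n := by omega
  rw [hhalf]
  have hinv := StandardYoungTableau.evacuateUpTo_involutive (μ := rectDiagram d m) (n := n)
    (by omega)
  have hprom := StandardYoungTableau.promotion_iterate_half (d := d) (m := m) (n := n) (by omega)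
  have hbij : Set.BijOn (StandardYoungTableau.evacuateUpTo n)
      {T : StandardYoungTableau (rectDiagram d m) | T.evacuation = T}
      {T : StandardYoungTableau (rectDiagram d m) |
        StandardYoungTableau.promotion^[n] T = T} := by
    refine ⟨fun T hT => ?_, hinv.injective.injOn, fun T hT => ⟨_, ?_, hinv T⟩⟩
    · have hT : T.evacuation = T := hT
      change StandardYoungTableau.promotion^[n] _ = _
      rw [hprom, hinv, hT]
    · have hT : StandardYoungTableau.promotion^[n] T = T := hT
      rw [hprom] at hT
      exact hinv.injective (hT.trans (hinv T).symm)
  refine ⟨Nat.card_congr hbij.equiv, funext fun T => ?_, hinv, hbij⟩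
  rw [Function.comp_apply, Function.comp_apply, hprom, hinv]
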